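/- There are a polynomial $P$ in three variables with real coefficients, a deterministic algorithm $\mathcal A$ and a polynomial $T$ with the following property. Let $0<\alpha<\beta<1$ and $\mu>0$ be real numbers. Then there is a positive integer $D\le P\bigl(1/\alpha,\,1/(\beta-\alpha),\,1/\mu\bigr)$ such that for all integers $1\le m\le n$ there is a bipartite multigraph $G=(L\cup R,E)$ with the following properties. 1. $|L|=n$ and $|R|=m$, every vertex in $L$ has degree $D$, and every vertex in $R$ has degree at least $D\lfloor n/m\rfloor$ and at most $2D\lfloor n/m\rfloor$ (hence at most $2Dn/m$). 2. $G$ is explicit: on input $(n,m,D)$ the algorithm $\mathcal A$ outputs the list of edges of $G$ in time at most $T(s)$, where $s=n+m+|E|$ is the size of $G$. Here an algorithm is a program for a random access machine with unit-cost addition and truncated subtraction (and no multiplication), whose time is polynomially related to that of a Turing machine. 3. For every $S\subseteq L$ with $|S|\le\alpha|L|$, let $Q$ be the set of all $v\in R$ such that more than a $\beta$-fraction of the edges at $v$ (counted with multiplicity) have their other endpoint in $S$. Then $|Q|<\mu|R|$. -/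

import Mathlib

/-! ## Bipartite multigraphs -/

/-- A finite bipartite multigraph with left part `Fin n` and right part `Fin m`: a finite multiset of
edges, each edge being a pair (left endpoint, right endpoint). -/
structure BipMultigraph (n m : ℕ) where
  edges : Multiset (Fin n × Fin m)

namespace BipMultigraph

variable {n m : ℕ}

/-- Degree of a left vertex, parallel edges counted with multiplicity. -/
def leftDegree (G : BipMultigraph n m) (u : Fin n) : ℕ :=
  G.edges.countP fun e => e.1 = u

/-- Degree of a right vertex, parallel edges counted with multiplicity. -/
def rightDegree (G : BipMultigraph n m) (v : Fin m) : ℕ :=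
  G.edges.countP fun e => e.2 = v

/-- Number of edges (with multiplicity) between the set `S` of left vertices and the right vertex
`v`, that is, the number of neighbours of `v` in `S`, counted with multiplicity. -/
def degreeFrom (G : BipMultigraph n m) (S : Finset (Fin n)) (v : Fin m) : ℕ :=
  G.edges.countP fun e => e.1 ∈ S ∧ e.2 = v

/-- The right vertices more than a `β`-fraction of whose neighbours lie in `S`. -/
noncomputable def overloaded (G : BipMultigraph n m) (β : ℝ) (S : Finset (Fin n)) :
    Finset (Fin m) :=
  Finset.univ.filter fun v => β * (G.rightDegree v : ℝ) < (G.degreeFrom S v : ℝ)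

/-- Number of vertices plus number of edges. -/
def size (G : BipMultigraph n m) : ℕ := n + m + G.edges.card

/-- The list `out` of natural numbers is an edge list of `G`: it reads `u₁, v₁, u₂, v₂, …`, where
`(u₁, v₁), (u₂, v₂), …` enumerates the edges of `G` with multiplicity, in some order. -/
def IsEdgeList (G : BipMultigraph n m) (out : List ℕ) : Prop :=
  ∃ l : List (Fin n × Fin m), (l : Multiset (Fin n × Fin m)) = G.edges ∧
    out = l.flatMap fun e => [(e.1 : ℕ), (e.2 : ℕ)]

end BipMultigraph

/-! ## Random access machines

Deterministic random access machines with structured control. Every elementary operation and every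
test costs one step. The only arithmetic is addition and truncated subtraction, so that a number has
`O(t)` bits after `t` steps, and the unit-cost time is polynomially related to Turing machine time. -/

namespace RAM

/-- The registers, and the sequence of numbers written to the output so far. -/
structure State where
  reg : ℕ → ℕ
  out : List ℕ

/-- The state after register `x` has been set to `a`. -/
def State.set (s : State) (x a : ℕ) : State :=
  { s with reg := Function.update s.reg x a }

/-- Programs; `R i` stands for the content of register `i`. -/
inductive Program where
  /-- no operation -/
  | skip : Program
  /-- `R x := a` -/
  | const (x a : ℕ) : Program
  /-- `R x := R y` -/
  | copy (x y : ℕ) : Program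
  /-- `R x := R y + R z` -/
  | add (x y z : ℕ) : Program
  /-- `R x := max (R y - R z) 0` -/
  | sub (x y z : ℕ) : Program
  /-- `R x := R (R y)` -/
  | load (x y : ℕ) : Program
  /-- `R (R x) := R y` -/
  | store (x y : ℕ) : Program
  /-- append `R x` to the output -/
  | write (x : ℕ) : Program
  /-- first `p`, then `q` -/
  | seq (p q : Program) : Program
  /-- if `R x ≠ 0` then `p` else `q` -/
  | ite (x : ℕ) (p q : Program) : Program
  /-- while `R x ≠ 0` do `p` -/
  | loop (x : ℕ) (p : Program) : Program

/-- `Exec p s s' t`: started in state `s`, the program `p` halts after exactly `t` steps, in the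
state `s'`. -/
inductive Exec : Program → State → State → ℕ → Prop
  | skip (s : State) : Exec .skip s s 1
  | const (s : State) (x a : ℕ) : Exec (.const x a) s (s.set x a) 1
  | copy (s : State) (x y : ℕ) : Exec (.copy x y) s (s.set x (s.reg y)) 1
  | add (s : State) (x y z : ℕ) : Exec (.add x y z) s (s.set x (s.reg y + s.reg z)) 1
  | sub (s : State) (x y z : ℕ) : Exec (.sub x y z) s (s.set x (s.reg y - s.reg z)) 1
  | load (s : State) (x y : ℕ) : Exec (.load x y) s (s.set x (s.reg (s.reg y))) 1
  | store (s : State) (x y : ℕ) : Exec (.store x y) s (s.set (s.reg x) (s.reg y)) 1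
  | write (s : State) (x : ℕ) : Exec (.write x) s { s with out := s.out ++ [s.reg x] } 1
  | seq {p q : Program} {s s' s'' : State} {t t' : ℕ} :
      Exec p s s' t → Exec q s' s'' t' → Exec (.seq p q) s s'' (t + t')
  | ite_true {x : ℕ} {p q : Program} {s s' : State} {t : ℕ} :
      s.reg x ≠ 0 → Exec p s s' t → Exec (.ite x p q) s s' (t + 1)
  | ite_false {x : ℕ} {p q : Program} {s s' : State} {t : ℕ} :
      s.reg x = 0 → Exec q s s' t → Exec (.ite x p q) s s' (t + 1)
  | loop_true {x : ℕ} {p : Program} {s s' s'' : State} {t t' : ℕ} :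
      s.reg x ≠ 0 → Exec p s s' t → Exec (.loop x p) s' s'' t' →
        Exec (.loop x p) s s'' (t + t' + 1)
  | loop_false {x : ℕ} {p : Program} {s : State} :
      s.reg x = 0 → Exec (.loop x p) s s 1

/-- The initial state on input `n, m, d`: these numbers stand in the registers `0, 1, 2`, all other
registers are `0`, and nothing has been written. -/
def initial (n m d : ℕ) : State where
  reg := fun i => if i = 0 then n else if i = 1 then m else if i = 2 then d else 0
  out := []

/-- On input `n, m, d` the program `p` halts within `T` steps, having written `out`. -/
def OutputsWithin (p : Program) (n m d : ℕ) (out : List ℕ) (T : ℕ) : Prop :=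
  ∃ (s : State) (t : ℕ), Exec p (initial n m d) s t ∧ s.out = out ∧ t ≤ T

end RAM

/-- The algorithm `p` builds the multigraph `G` from the input `n, m, d`, in time at most `T`
evaluated at the size of `G`. -/
def BuildsInTime (p : RAM.Program) (T : Polynomial ℕ) {n m : ℕ} (d : ℕ) (G : BipMultigraph n m) :
    Prop :=
  ∃ out : List ℕ, G.IsEdgeList out ∧ RAM.OutputsWithin p n m d out (T.eval G.size)

/-! ## A spectral gap for shears of the discrete torus -/

/-! The graph comes from an expander on the torus `(ℤ/k)²` with `k = ⌊√n⌋`. Eight affine shears,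
which add `±2` times one coordinate and a translation by `0` or `1` to the other, generate a walk.
On the Fourier side a shear acts on frequencies by its inverse transpose, and averaging over the
translation damps the frequency `a` by `cos (π|a|/k)`. AM-GM with weights `4/5` and `5/4`, chosen by
whether `|·|` grows or shrinks, bounds the averaging operator by `73/80` on functions of mean zero
(`damp_mul_shearWeight_le`, `sum_average_sq_le`). Cauchy–Schwarz turns this into mixing after `t`
steps (`sum_card_walk_le`).

The words of length `t` give `D = 8^t` permutations of the left vertices; the at most `2√n` vertices
outside the torus stay fixed. Each `u` is joined to the residues modulo `m` of its `D` images. If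
`|Q| ≥ μm`, the set `L` of numbers with residue in `Q` has at least `μn/2` elements. Overloading
forces more than `βD|L|` edges from `S` into `L`, while mixing allows only `D(α|L| + 4√n + (73/80)^t
n)`. For `t` logarithmic in the parameters this is a contradiction (`card_overloaded_lt`), and `D`
is polynomial.

As `D` may not depend on `n`, small `n` need another family: if `n² ≤ D`, the cyclic shifts `u + j`
are already nearly uniform.

The program runs through all `u` and `j` and follows the base `8` digits of `j`, with division,
product and square root done by repeated addition and subtraction (`outputsWithin_build`). -/

namespace Torus

/-- The comparison weight of two absolute values. -/
noncomputable def weight (a b : ℕ) : ℝ := if a < b then 4 / 5 else if b < a then 5 / 4 else 1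

lemma weight_of_lt {a b : ℕ} (h : a < b) : weight a b = 4 / 5 := by simp [weight, h]

lemma weight_self (a : ℕ) : weight a a = 1 := by simp [weight]

lemma weight_pos (a b : ℕ) : 0 < weight a b := by
  unfold weight; split_ifs <;> norm_num

lemma weight_le (a b : ℕ) : weight a b ≤ 5 / 4 := by
  unfold weight; split_ifs <;> norm_num

lemma weight_mul_weight (a b : ℕ) : weight a b * weight b a = 1 := by
  rcases lt_trichotomy a b with h | h | h
  · simp [weight, h, h.not_gt]
  · simp [weight, h]
  · simp [weight, h, h.not_gt]

lemma two_mul_mul_le_weight (a b : ℕ) (x y : ℝ) :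
    2 * (x * y) ≤ weight a b * x ^ 2 + weight b a * y ^ 2 := by
  have h := weight_mul_weight a b
  have hp := weight_pos a b
  have hq := weight_pos b a
  have h2 : 0 ≤ weight b a * (weight a b * x - y) ^ 2 := by positivity
  have h3 : weight b a * (weight a b * x - y) ^ 2 =
      (weight a b * weight b a) * weight a b * x ^ 2 - 2 * (weight a b * weight b a) * (x * y)
        + weight b a * y ^ 2 := by ring
  rw [h3, h] at h2
  linarith

/-! ### Absolute values of residues under shears -/

variable {k : ℕ}

/-- The distance of a residue from `0`. -/
def size (a : ZMod k) : ℕ := a.valMinAbs.natAbs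

lemma size_neg (a : ZMod k) : size (-a) = size a := ZMod.natAbs_valMinAbs_neg a

lemma size_eq_zero {a : ZMod k} : size a = 0 ↔ a = 0 := by
  simp [size, ZMod.valMinAbs_eq_zero]

/-- Every other integer congruent to `w` has absolute value at least `k - |w| > l`. -/
lemma lt_size_intCast [NeZero k] {w : ℤ} {l : ℕ} (h : l < w.natAbs) (h' : w.natAbs + l < k) :
    l < size (w : ZMod k) := by
  by_contra! hc
  unfold size at hc
  have h1 : (((w : ZMod k).valMinAbs : ℤ) : ZMod k) = (w : ZMod k) := ZMod.coe_valMinAbs _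
  rw [ZMod.intCast_eq_intCast_iff_dvd_sub] at h1
  obtain ⟨q, hq⟩ := h1
  generalize (w : ZMod k).valMinAbs = v at *
  rcases lt_trichotomy q 0 with h0 | h0 | h0
  · have : (k : ℤ) * q ≤ -k := by nlinarith
    omega
  · subst h0; omega
  · have : (k : ℤ) ≤ k * q := by nlinarith
    omega

/-- The factor `2` matters: `2|a| - |b| > |b|`. Wrap-around is excluded by `|b + 2a| + |b| ≤ 2(|a| +
|b|) < k`. -/
lemma lt_size_add_two_mul [NeZero k] {a b : ZMod k} (h : 2 * (size a + size b) < k)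
    (hab : size b < size a) : size b < size (b + 2 * a) := by
  have e : b + 2 * a = ((b.valMinAbs + 2 * a.valMinAbs : ℤ) : ZMod k) := by
    simp
  rw [e]
  unfold size at *
  apply lt_size_intCast <;> omega

lemma lt_size_sub_two_mul [NeZero k] {a b : ZMod k} (h : 2 * (size a + size b) < k)
    (hab : size b < size a) : size b < size (b - 2 * a) := by
  have := lt_size_add_two_mul (a := -a) (b := b) (by rwa [size_neg]) (by rwa [size_neg])
  rwa [mul_neg, ← sub_eq_add_neg] at this

/-- For one choice of sign there is no cancellation, and the absolute value becomes `|a| + 2|b|`. -/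
lemma lt_size_add_or_sub [NeZero k] {a b : ZMod k} (h : 2 * (size a + size b) < k)
    (hb : size b ≠ 0) : size a < size (a + 2 * b) ∨ size a < size (a - 2 * b) := by
  have e : a + 2 * b = ((a.valMinAbs + 2 * b.valMinAbs : ℤ) : ZMod k) := by
    simp
  have e' : a - 2 * b = ((a.valMinAbs - 2 * b.valMinAbs : ℤ) : ZMod k) := by
    simp
  rw [e, e']
  unfold size at h hb
  by_cases hs : (a.valMinAbs + 2 * b.valMinAbs).natAbs =
      a.valMinAbs.natAbs + 2 * b.valMinAbs.natAbs
  · left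
    apply lt_size_intCast <;> unfold size <;> omega
  · right
    apply lt_size_intCast <;> unfold size <;> omega

/-- The total weight of the two shears moving the coordinate `b` by `±2a`. -/
noncomputable def shearWeight (a b : ZMod k) : ℝ :=
  weight (size b) (size (b + 2 * a)) + weight (size b) (size (b - 2 * a))

lemma shearWeight_nonneg (a b : ZMod k) : 0 ≤ shearWeight a b :=
  add_nonneg (weight_pos _ _).le (weight_pos _ _).le

lemma shearWeight_le (a b : ZMod k) : shearWeight a b ≤ 5 / 2 := by
  have := weight_le (size b) (size (b + 2 * a))
  have := weight_le (size b) (size (b - 2 * a))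
  unfold shearWeight; linarith

lemma shearWeight_of_lt [NeZero k] {a b : ZMod k} (h : 2 * (size a + size b) < k)
    (hab : size b < size a) : shearWeight a b = 8 / 5 := by
  rw [shearWeight, weight_of_lt (lt_size_add_two_mul h hab),
    weight_of_lt (lt_size_sub_two_mul h hab)]
  norm_num

/-- If `b ≠ 0`, one of the two shears has weight `4/5`, so the sum is at most `4/5 + 5/4 = 41/20`.
-/
lemma shearWeight_le_of_small [NeZero k] {a b : ZMod k} (h : 2 * (size a + size b) < k) :
    shearWeight b a ≤ 41 / 20 := by
  by_cases hb : size b = 0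
  · rw [size_eq_zero] at hb
    subst hb
    simp [shearWeight, weight_self]; norm_num
  · have h1 := weight_le (size a) (size (a + 2 * b))
    have h2 := weight_le (size a) (size (a - 2 * b))
    unfold shearWeight
    rcases lt_size_add_or_sub h hb with h3 | h3
    · rw [weight_of_lt h3]; linarith
    · rw [weight_of_lt h3]; linarith

/-- Here `a = ±b`, so one shear negates `a` (weight `1`) and the other enlarges it (weight `4/5`).
-/
lemma shearWeight_of_size_eq [NeZero k] {a b : ZMod k} (h : 2 * (size a + size b) < k)
    (hab : size a = size b) (hb : size b ≠ 0) : shearWeight b a = 9 / 5 := by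
  have h0 := lt_size_add_or_sub h hb
  have h1 : size a = size (a + 2 * b) ∨ size a = size (a - 2 * b) := by
    rcases (ZMod.natAbs_valMinAbs_eq_natAbs_valMinAbs).1 hab with e | e
    · right
      rw [e, show b - 2 * b = -b by ring, size_neg]
    · left
      rw [e, show -b + 2 * b = b by ring, size_neg]
  unfold shearWeight
  rcases h1 with h1 | h1 <;> rcases h0 with h0 | h0
  · omega
  · rw [weight_of_lt h0, ← h1, weight_self]; norm_num
  · rw [weight_of_lt h0, ← h1, weight_self]; norm_num
  · omega

/-- Unequal sizes give the constant: `8/5 + 41/20 = 73/20`. Equal sizes give `9/5 + 9/5`, which is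
less. -/
lemma shearWeight_add_le [NeZero k] {a b : ZMod k} (h : 2 * (size a + size b) < k)
    (h0 : (a, b) ≠ 0) : shearWeight a b + shearWeight b a ≤ 73 / 20 := by
  have h' : 2 * (size b + size a) < k := by omega
  rcases lt_trichotomy (size a) (size b) with hab | hab | hab
  · have := shearWeight_of_lt h' hab
    have := shearWeight_le_of_small h'
    linarith
  · have hb : size b ≠ 0 := by
      intro hb
      apply h0
      rw [hb] at hab
      rw [size_eq_zero] at hb hab
      simp [hb, hab]
    have := shearWeight_of_size_eq h hab hb
    have := shearWeight_of_size_eq h' hab.symm (hab ▸ hb)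
    linarith
  · have := shearWeight_of_lt h hab
    have := shearWeight_le_of_small h
    linarith

/-! ### Damping of high frequencies -/

/-- The damping factor that a unit translation produces at the frequency `a`. -/
noncomputable def damp [NeZero k] (a : ZMod k) : ℝ := ‖1 + ZMod.stdAddChar a‖ / 2

lemma damp_nonneg [NeZero k] (a : ZMod k) : 0 ≤ damp a := by unfold damp; positivity

lemma norm_one_add_exp (θ : ℝ) : ‖1 + Complex.exp (θ * Complex.I)‖ = 2 * |Real.cos (θ / 2)| := by
  have h : 1 + Complex.exp (θ * Complex.I) =
      Complex.exp ((θ / 2 : ℝ) * Complex.I) * ((2 * Real.cos (θ / 2) : ℝ) : ℂ) := by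
    have e1 : Complex.exp (θ * Complex.I) = Complex.exp ((θ / 2 : ℝ) * Complex.I) *
        Complex.exp ((θ / 2 : ℝ) * Complex.I) := by
      rw [← Complex.exp_add]; congr 1; push_cast; ring
    have e2 : (1 : ℂ) = Complex.exp ((θ / 2 : ℝ) * Complex.I) *
        Complex.exp (-((θ / 2 : ℝ) : ℂ) * Complex.I) := by
      rw [← Complex.exp_add]; simp
    rw [Complex.ofReal_mul, Complex.ofReal_cos, Complex.ofReal_ofNat, Complex.two_cos, mul_add,
      ← e1, ← e2, add_comm]
  rw [h, norm_mul, Complex.norm_exp_ofReal_mul_I, one_mul, Complex.norm_real, Real.norm_eq_abs,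
    abs_mul, abs_two]

lemma damp_eq [NeZero k] (a : ZMod k) : damp a = Real.cos (Real.pi * size a / k) := by
  have hk : (0 : ℝ) < k := by exact_mod_cast NeZero.pos k
  have h1 : ZMod.stdAddChar a =
      Complex.exp ((2 * Real.pi * a.valMinAbs / k : ℝ) * Complex.I) := by
    conv_lhs => rw [← ZMod.coe_valMinAbs a]
    rw [ZMod.stdAddChar_coe]
    congr 1; push_cast; ring
  have h2 : (size a : ℝ) = |(a.valMinAbs : ℝ)| := by
    rw [size, Nat.cast_natAbs, Int.cast_abs]
  have h3 : Real.cos (2 * Real.pi * a.valMinAbs / k / 2) = Real.cos (Real.pi * size a / k) := by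
    rw [h2, ← Real.cos_abs]
    congr 1
    rw [abs_div, abs_div, abs_mul, abs_mul, abs_of_pos Real.pi_pos, abs_of_pos hk, abs_two]
    ring
  rw [damp, h1, norm_one_add_exp, h3, abs_of_nonneg]
  · ring
  · have h4 : size a ≤ k / 2 := ZMod.natAbs_valMinAbs_le a
    have h5 : (2 : ℝ) * size a ≤ k := by
      have : 2 * size a ≤ k := by omega
      exact_mod_cast this
    apply Real.cos_nonneg_of_neg_pi_div_two_le_of_le
    · have : 0 ≤ Real.pi * size a / k := by positivity
      linarith [Real.pi_pos]
    · rw [div_le_div_iff₀ hk two_pos]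
      nlinarith [Real.pi_pos]

lemma damp_le_one [NeZero k] (a : ZMod k) : damp a ≤ 1 := by
  rw [damp_eq]; exact Real.cos_le_one _

/-- In `cos x + cos y = 2 cos ((x + y)/2) cos ((x - y)/2)` the half sum is at least `π/4`. -/
lemma damp_add_damp_le [NeZero k] {a b : ZMod k} (h : k ≤ 2 * (size a + size b)) :
    damp a + damp b ≤ √2 := by
  have hk : (0 : ℝ) < k := by exact_mod_cast NeZero.pos k
  have ha : size a ≤ k / 2 := ZMod.natAbs_valMinAbs_le a
  have hb : size b ≤ k / 2 := ZMod.natAbs_valMinAbs_le b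
  have ha' : (2 : ℝ) * size a ≤ k := by
    have : 2 * size a ≤ k := by omega
    exact_mod_cast this
  have hb' : (2 : ℝ) * size b ≤ k := by
    have : 2 * size b ≤ k := by omega
    exact_mod_cast this
  have h' : (k : ℝ) ≤ 2 * (size a + size b) := by exact_mod_cast h
  rw [damp_eq, damp_eq, Real.cos_add_cos]
  have e : (Real.pi * size a / k + Real.pi * size b / k) / 2 =
      Real.pi * (size a + size b) / (2 * k) := by field_simp
  have h1 : Real.cos ((Real.pi * size a / k + Real.pi * size b / k) / 2) ≤ √2 / 2 := by
    rw [e, ← Real.cos_pi_div_four]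
    apply Real.cos_le_cos_of_nonneg_of_le_pi
    · positivity
    · rw [div_le_iff₀ (by positivity)]
      nlinarith [Real.pi_pos]
    · rw [div_le_div_iff₀ (by norm_num) (by positivity)]
      nlinarith [Real.pi_pos]
  have h2 : 0 ≤ Real.cos ((Real.pi * size a / k + Real.pi * size b / k) / 2) := by
    rw [e]
    apply Real.cos_nonneg_of_neg_pi_div_two_le_of_le
    · have : 0 ≤ Real.pi * (size a + size b) / (2 * k) := by positivity
      linarith [Real.pi_pos]
    · rw [div_le_div_iff₀ (by positivity) two_pos]
      nlinarith [Real.pi_pos]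
  have h3 := Real.cos_le_one ((Real.pi * size a / k - Real.pi * size b / k) / 2)
  nlinarith

/-- Low frequencies are controlled by the weights alone, high ones by damping, since `5/2 · √2 <
73/20`. -/
lemma damp_mul_shearWeight_le [NeZero k] {a b : ZMod k} (h0 : (a, b) ≠ 0) :
    damp a * shearWeight a b + damp b * shearWeight b a ≤ 73 / 20 := by
  by_cases h : 2 * (size a + size b) < k
  · have h1 := shearWeight_add_le h h0
    have h2 := mul_le_mul_of_nonneg_right (damp_le_one a) (shearWeight_nonneg a b)
    have h3 := mul_le_mul_of_nonneg_right (damp_le_one b) (shearWeight_nonneg b a)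
    linarith
  · have h1 := damp_add_damp_le (not_lt.1 h)
    have h2 := mul_le_mul_of_nonneg_left (shearWeight_le a b) (damp_nonneg a)
    have h3 := mul_le_mul_of_nonneg_left (shearWeight_le b a) (damp_nonneg b)
    have h4 : √2 ≤ 1.46 := by
      rw [Real.sqrt_le_left (by norm_num)]; norm_num
    linarith

/-! ### The weighted inequality summed over frequencies -/

/-- The shear that adds `c` times the first coordinate to the second. -/
def shearSnd (c : ZMod k) : Equiv.Perm (ZMod k × ZMod k) where
  toFun z := (z.1, z.2 + c * z.1)
  invFun z := (z.1, z.2 - c * z.1)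
  left_inv z := by simp
  right_inv z := by simp

/-- The shear that adds `c` times the second coordinate to the first. -/
def shearFst (c : ZMod k) : Equiv.Perm (ZMod k × ZMod k) where
  toFun z := (z.1 + c * z.2, z.2)
  invFun z := (z.1 - c * z.2, z.2)
  left_inv z := by simp
  right_inv z := by simp

/-- The sum of a function over the four shears of a frequency, damped. -/
noncomputable def shearSum [NeZero k] (H : ZMod k × ZMod k → ℝ) (z : ZMod k × ZMod k) : ℝ :=
  damp z.1 * (H (shearSnd 2 z) + H (shearSnd (-2) z)) +
    damp z.2 * (H (shearFst 2 z) + H (shearFst (-2) z))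

/-- The second sum is reindexed by the shear; the damping is unaffected because it depends only on
the coordinate that the shear fixes. -/
lemma sum_shearSnd_le [NeZero k] (c : ZMod k) (G H : ZMod k × ZMod k → ℝ) :
    2 * ∑ z, damp z.1 * (G z * H (shearSnd c z)) ≤
      ∑ z : ZMod k × ZMod k, damp z.1 * weight (size z.2) (size (z.2 + c * z.1)) * G z ^ 2 +
        ∑ z : ZMod k × ZMod k, damp z.1 * weight (size z.2) (size (z.2 - c * z.1)) * H z ^ 2 := by
  have e : ∑ z : ZMod k × ZMod k, damp z.1 * weight (size z.2) (size (z.2 - c * z.1)) * H z ^ 2 =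
      ∑ z : ZMod k × ZMod k, damp z.1 * weight (size (z.2 + c * z.1)) (size z.2) *
        H (shearSnd c z) ^ 2 := by
    rw [← Equiv.sum_comp (shearSnd c)]
    simp [shearSnd]
  rw [e, ← Finset.sum_add_distrib, Finset.mul_sum]
  apply Finset.sum_le_sum
  intro z _
  have := mul_le_mul_of_nonneg_left (two_mul_mul_le_weight (size z.2) (size (z.2 + c * z.1)) (G z)
    (H (shearSnd c z))) (damp_nonneg z.1)
  linarith

lemma sum_shearFst_le [NeZero k] (c : ZMod k) (G H : ZMod k × ZMod k → ℝ) :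
    2 * ∑ z, damp z.2 * (G z * H (shearFst c z)) ≤
      ∑ z : ZMod k × ZMod k, damp z.2 * weight (size z.1) (size (z.1 + c * z.2)) * G z ^ 2 +
        ∑ z : ZMod k × ZMod k, damp z.2 * weight (size z.1) (size (z.1 - c * z.2)) * H z ^ 2 := by
  have e : ∑ z : ZMod k × ZMod k, damp z.2 * weight (size z.1) (size (z.1 - c * z.2)) * H z ^ 2 =
      ∑ z : ZMod k × ZMod k, damp z.2 * weight (size (z.1 + c * z.2)) (size z.1) *
        H (shearFst c z) ^ 2 := by
    rw [← Equiv.sum_comp (shearFst c)]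
    simp [shearFst]
  rw [e, ← Finset.sum_add_distrib, Finset.mul_sum]
  apply Finset.sum_le_sum
  intro z _
  have := mul_le_mul_of_nonneg_left (two_mul_mul_le_weight (size z.1) (size (z.1 + c * z.2)) (G z)
    (H (shearFst c z))) (damp_nonneg z.2)
  linarith

lemma sum_weight_le [NeZero k] {G : ZMod k × ZMod k → ℝ} (hG : G 0 = 0) :
    ∑ z : ZMod k × ZMod k, (damp z.1 * shearWeight z.1 z.2 + damp z.2 * shearWeight z.2 z.1) *
      G z ^ 2 ≤ 73 / 20 * ∑ z, G z ^ 2 := by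
  rw [Finset.mul_sum]
  apply Finset.sum_le_sum
  intro z _
  by_cases hz : z = 0
  · simp [hz, hG]
  · exact mul_le_mul_of_nonneg_right (damp_mul_shearWeight_le hz) (sq_nonneg _)

lemma sum_mul_shearSum_le [NeZero k] {G H : ZMod k × ZMod k → ℝ} (hG : G 0 = 0) (hH : H 0 = 0) :
    ∑ z, G z * shearSum H z ≤ 73 / 40 * (∑ z, G z ^ 2 + ∑ z, H z ^ 2) := by
  have h1 := sum_shearSnd_le 2 G H
  have h2 := sum_shearSnd_le (-2) G H
  have h3 := sum_shearFst_le 2 G H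
  have h4 := sum_shearFst_le (-2) G H
  have h5 := sum_weight_le hG
  have h6 := sum_weight_le hH
  simp only [shearWeight, neg_mul, sub_neg_eq_add, ← sub_eq_add_neg, mul_add, add_mul,
    Finset.sum_add_distrib, shearSum] at *
  have e : ∀ a b c : ℝ, a * (b * c) = b * (a * c) := fun a b c => by ring
  simp only [e (G _)]
  linarith

lemma sum_sq_le_of_le_shearSum [NeZero k] {G H : ZMod k × ZMod k → ℝ} (hG : G 0 = 0)
    (hH : H 0 = 0) (h0 : ∀ z, 0 ≤ G z) (h : ∀ z, G z ≤ shearSum H z / 4) :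
    ∑ z, G z ^ 2 ≤ (73 / 80) ^ 2 * ∑ z, H z ^ 2 := by
  -- Scaling by the inverse of the target norm balances the two squares: the `G` term on the right
  -- becomes half of the left side and is absorbed.
  have h1 := sum_mul_shearSum_le (G := fun z => 80 / 73 * G z) (by simp [hG]) hH
  have h2 : ∑ z, G z ^ 2 ≤ 73 / 320 * ∑ z, 80 / 73 * G z * shearSum H z := by
    rw [Finset.mul_sum]
    apply Finset.sum_le_sum
    intro z _
    have := mul_le_mul_of_nonneg_left (h z) (h0 z)
    linarith
  simp only [mul_pow, ← Finset.mul_sum] at h1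
  linarith

/-! ### Fourier analysis on the torus -/

/-- The discrete Fourier transform on the torus. -/
noncomputable def fourier [NeZero k] (f : ZMod k × ZMod k → ℝ) (z : ZMod k × ZMod k) : ℂ :=
  ∑ w : ZMod k × ZMod k, (f w : ℂ) * ZMod.stdAddChar (-(z.1 * w.1 + z.2 * w.2))

lemma fourier_zero [NeZero k] (f : ZMod k × ZMod k → ℝ) : fourier f 0 = (∑ w, f w : ℝ) := by
  simp [fourier]

lemma sum_stdAddChar [NeZero k] (w : ZMod k × ZMod k) :
    ∑ z : ZMod k × ZMod k, ZMod.stdAddChar (z.1 * w.1 + z.2 * w.2) =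
      if w = 0 then ((k : ℂ) ^ 2) else 0 := by
  have h : ∀ b : ZMod k, ∑ x : ZMod k, ZMod.stdAddChar (x * b) = if b = 0 then (k : ℂ) else 0 := by
    intro b
    rw [AddChar.sum_mulShift b (ZMod.isPrimitive_stdAddChar k), ZMod.card]
    simp
  rw [Fintype.sum_prod_type]
  simp only [AddChar.map_add_eq_mul, ← Finset.mul_sum, ← Finset.sum_mul, h]
  rcases w with ⟨w1, w2⟩
  by_cases h1 : w1 = 0 <;> by_cases h2 : w2 = 0 <;> simp [h1, h2, sq]

lemma conj_stdAddChar [NeZero k] (a : ZMod k) :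
    (starRingEnd ℂ) (ZMod.stdAddChar a) = ZMod.stdAddChar (-a) := by
  rw [AddChar.map_neg_eq_conj]

lemma sum_norm_fourier_sq [NeZero k] (f : ZMod k × ZMod k → ℝ) :
    ∑ z, ‖fourier f z‖ ^ 2 = (k : ℝ) ^ 2 * ∑ z, f z ^ 2 := by
  have h : ((∑ z, ‖fourier f z‖ ^ 2 : ℝ) : ℂ) = (((k : ℝ) ^ 2 * ∑ z, f z ^ 2 : ℝ) : ℂ) := by
    have e1 : ∀ z, ((‖fourier f z‖ ^ 2 : ℝ) : ℂ) = ∑ w, ∑ w', (f w : ℂ) * (f w' : ℂ) *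
        ZMod.stdAddChar (z.1 * (w' - w).1 + z.2 * (w' - w).2) := by
      intro z
      rw [Complex.ofReal_pow, ← Complex.mul_conj', fourier, map_sum, Finset.sum_mul_sum]
      refine Finset.sum_congr rfl fun w _ => Finset.sum_congr rfl fun w' _ => ?_
      rw [map_mul, Complex.conj_ofReal, conj_stdAddChar, neg_neg, mul_mul_mul_comm,
        ← AddChar.map_add_eq_mul]
      congr 2
      simp only [Prod.fst_sub, Prod.snd_sub]
      ring
    push_cast
    rw [Finset.mul_sum]
    have e2 : ∑ z, (‖fourier f z‖ : ℂ) ^ 2 = ∑ w, ∑ w', (f w : ℂ) * (f w' : ℂ) *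
        (if w' - w = 0 then ((k : ℂ) ^ 2) else 0) := by
      have e3 : ∀ z, (‖fourier f z‖ : ℂ) ^ 2 = ∑ w, ∑ w', (f w : ℂ) * (f w' : ℂ) *
        ZMod.stdAddChar (z.1 * (w' - w).1 + z.2 * (w' - w).2) := by
        intro z
        rw [← e1 z]; push_cast; rfl
      rw [Finset.sum_congr rfl fun z _ => e3 z, Finset.sum_comm]
      refine Finset.sum_congr rfl fun w _ => ?_
      rw [Finset.sum_comm]
      refine Finset.sum_congr rfl fun w' _ => ?_
      rw [← Finset.mul_sum, sum_stdAddChar]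
    rw [e2]
    refine Finset.sum_congr rfl fun w _ => ?_
    simp only [sub_eq_zero, mul_ite, mul_zero, Finset.sum_ite_eq', Finset.mem_univ, if_true]
    ring
  exact_mod_cast h

/-- Moving the shear across the pairing of point and frequency gives its inverse transpose, which
acts on the other coordinate; the translation becomes a character. -/
lemma fourier_comp_shearFst [NeZero k] (f : ZMod k × ZMod k → ℝ) (c s : ZMod k) (z : ZMod k × ZMod k) :
    fourier (fun w => f (shearFst c w + (s, 0))) z =
      ZMod.stdAddChar (z.1 * s) * fourier f (shearSnd (-c) z) := by
  unfold fourier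
  rw [Finset.mul_sum]
  conv_rhs => rw [← Equiv.sum_comp ((shearFst c).trans (Equiv.addRight (s, 0)))]
  refine Finset.sum_congr rfl fun w _ => ?_
  rw [mul_left_comm, ← AddChar.map_add_eq_mul]
  simp only [Equiv.trans_apply, Equiv.coe_addRight, shearFst, shearSnd, Equiv.coe_fn_mk,
    Prod.mk_add_mk, add_zero]
  congr 2
  ring

lemma fourier_comp_shearSnd [NeZero k] (f : ZMod k × ZMod k → ℝ) (c s : ZMod k) (z : ZMod k × ZMod k) :
    fourier (fun w => f (shearSnd c w + (0, s))) z =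
      ZMod.stdAddChar (z.2 * s) * fourier f (shearFst (-c) z) := by
  unfold fourier
  rw [Finset.mul_sum]
  conv_rhs => rw [← Equiv.sum_comp ((shearSnd c).trans (Equiv.addRight (0, s)))]
  refine Finset.sum_congr rfl fun w _ => ?_
  rw [mul_left_comm, ← AddChar.map_add_eq_mul]
  simp only [Equiv.trans_apply, Equiv.coe_addRight, shearFst, shearSnd, Equiv.coe_fn_mk,
    Prod.mk_add_mk, add_zero]
  congr 2
  ring

/-! ### The walk and its mixing -/

/-- The eight affine shears generating the walk. -/
def step (k : ℕ) (r : ℕ) : Equiv.Perm (ZMod k × ZMod k) :=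
  if r < 2 then (shearFst 2).trans (Equiv.addRight (((r : ℕ) : ZMod k), 0))
  else if r < 4 then (shearFst (-2)).trans (Equiv.addRight (((r - 2 : ℕ) : ZMod k), 0))
  else if r < 6 then (shearSnd 2).trans (Equiv.addRight (0, ((r - 4 : ℕ) : ZMod k)))
  else (shearSnd (-2)).trans (Equiv.addRight (0, ((r - 6 : ℕ) : ZMod k)))

/-- The averaging operator of the walk. -/
noncomputable def average (f : ZMod k × ZMod k → ℝ) (z : ZMod k × ZMod k) : ℝ :=
  (∑ r ∈ Finset.range 8, f (step k r z)) / 8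

lemma sum_average [NeZero k] (f : ZMod k × ZMod k → ℝ) : ∑ z, average f z = ∑ z, f z := by
  unfold average
  rw [← Finset.sum_div, Finset.sum_comm]
  simp only [Equiv.sum_comp]
  simp

lemma fourier_average [NeZero k] (f : ZMod k × ZMod k → ℝ) (z : ZMod k × ZMod k) :
    fourier (average f) z =
      ((1 + ZMod.stdAddChar z.1) * (fourier f (shearSnd 2 z) + fourier f (shearSnd (-2) z)) +
        (1 + ZMod.stdAddChar z.2) * (fourier f (shearFst 2 z) + fourier f (shearFst (-2) z))) / 8 := by
  have e : fourier (average f) z =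
      (∑ r ∈ Finset.range 8, fourier (fun w => f (step k r w)) z) / 8 := by
    unfold fourier average
    rw [Finset.sum_comm, Finset.sum_div]
    refine Finset.sum_congr rfl fun w _ => ?_
    push_cast
    rw [← Finset.sum_mul]
    ring
  have h1 := fun c s => fourier_comp_shearFst f c s z
  have h2 := fun c s => fourier_comp_shearSnd f c s z
  rw [e]
  simp only [Finset.sum_range_succ, Finset.sum_range_zero, step]
  norm_num [h1, h2]
  ring

lemma norm_fourier_average_le [NeZero k] (f : ZMod k × ZMod k → ℝ) (z : ZMod k × ZMod k) :
    ‖fourier (average f) z‖ ≤ shearSum (fun w => ‖fourier f w‖) z / 4 := by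
  rw [fourier_average, norm_div]
  have h : ∀ a b c d e g : ℂ, ‖a * (b + c) + d * (e + g)‖ ≤
      ‖a‖ * (‖b‖ + ‖c‖) + ‖d‖ * (‖e‖ + ‖g‖) := by
    intro a b c d e g
    refine (norm_add_le _ _).trans ?_
    rw [norm_mul, norm_mul]
    gcongr <;> exact norm_add_le _ _
  refine (div_le_div_of_nonneg_right (h _ _ _ _ _ _) (norm_nonneg _)).trans (le_of_eq ?_)
  simp only [shearSum, damp]
  norm_num
  ring

/-- Mean zero removes the frequency `0`, the only one at which the weight bound is not available;
Parseval carries the bound back. -/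
lemma sum_average_sq_le [NeZero k] {f : ZMod k × ZMod k → ℝ} (hf : ∑ z, f z = 0) :
    ∑ z, average f z ^ 2 ≤ (73 / 80) ^ 2 * ∑ z, f z ^ 2 := by
  have hk : (0 : ℝ) < (k : ℝ) ^ 2 := by
    have : (0 : ℝ) < k := by exact_mod_cast NeZero.pos k
    positivity
  have h := sum_sq_le_of_le_shearSum (G := fun z => ‖fourier (average f) z‖)
    (H := fun z => ‖fourier f z‖) (by simp [fourier_zero, sum_average, hf])
    (by simp [fourier_zero, hf]) (fun z => norm_nonneg _) (norm_fourier_average_le f)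
  rw [sum_norm_fourier_sq, sum_norm_fourier_sq, mul_left_comm] at h
  exact le_of_mul_le_mul_left h hk

lemma sum_iterate_average [NeZero k] (f : ZMod k × ZMod k → ℝ) (t : ℕ) :
    ∑ z, average^[t] f z = ∑ z, f z := by
  induction t with
  | zero => rfl
  | succ t ih => rw [Function.iterate_succ_apply', sum_average, ih]

lemma sum_iterate_average_sq_le [NeZero k] {f : ZMod k × ZMod k → ℝ} (hf : ∑ z, f z = 0) (t : ℕ) :
    ∑ z, average^[t] f z ^ 2 ≤ ((73 / 80) ^ t) ^ 2 * ∑ z, f z ^ 2 := by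
  induction t with
  | zero => simp
  | succ t ih =>
    rw [Function.iterate_succ_apply']
    refine (sum_average_sq_le (by rw [sum_iterate_average, hf])).trans ?_
    rw [pow_succ' (73 / 80 : ℝ) t, mul_pow, mul_assoc]
    gcongr

/-- The composition of the `t` steps given by the base `8` digits of `j`. -/
def walk (k : ℕ) : ℕ → ℕ → Equiv.Perm (ZMod k × ZMod k)
  | 0, _ => Equiv.refl _
  | t + 1, j => (step k (j % 8)).trans (walk k t (j / 8))

lemma sum_range_mul_eq {M : Type*} [AddCommMonoid M] (a b : ℕ) (f : ℕ → M) :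
    ∑ j ∈ Finset.range (b * a), f j =
      ∑ r ∈ Finset.range a, ∑ i ∈ Finset.range b, f (a * i + r) := by
  induction b with
  | zero => simp
  | succ b ih =>
    rw [add_mul, one_mul, Finset.sum_range_add, ih]
    simp only [Finset.sum_range_succ, Finset.sum_add_distrib, mul_comm]

lemma sum_walk (t : ℕ) (f : ZMod k × ZMod k → ℝ) (z : ZMod k × ZMod k) :
    ∑ j ∈ Finset.range (8 ^ t), f (walk k t j z) = 8 ^ t * average^[t] f z := by
  induction t generalizing z with
  | zero => simp [walk]
  | succ t ih =>
    rw [pow_succ, sum_range_mul_eq, Function.iterate_succ_apply', average, pow_succ]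
    rw [mul_assoc, mul_div_cancel₀ _ (by norm_num : (8 : ℝ) ≠ 0), Finset.mul_sum]
    refine Finset.sum_congr rfl fun r hr => ?_
    rw [← ih]
    refine Finset.sum_congr rfl fun i _ => ?_
    rw [Finset.mem_range] at hr
    rw [walk, Nat.mul_add_mod, Nat.mod_eq_of_lt hr, Nat.mul_add_div (by norm_num),
      Nat.div_eq_of_lt hr, add_zero]
    rfl

lemma iterate_average_add_const (f : ZMod k × ZMod k → ℝ) (c : ℝ) (t : ℕ) :
    average^[t] (fun z => f z + c) = fun z => average^[t] f z + c := by
  induction t with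
  | zero => rfl
  | succ t ih =>
    rw [Function.iterate_succ_apply', ih, Function.iterate_succ_apply']
    ext z
    simp only [average, Finset.sum_add_distrib, Finset.sum_const, Finset.card_range]
    norm_num
    ring

/-- Expander mixing for the walk on the torus. -/
lemma sum_card_walk_le [NeZero k] (t : ℕ) (S Q : Finset (ZMod k × ZMod k)) :
    ((∑ j ∈ Finset.range (8 ^ t), (S.filter fun z => walk k t j z ∈ Q).card : ℕ) : ℝ) ≤
      8 ^ t * ((S.card : ℝ) * Q.card / (k : ℝ) ^ 2 + (73 / 80) ^ t * (k : ℝ) ^ 2) := by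
  have hk : (0 : ℝ) < (k : ℝ) ^ 2 := by
    have : (0 : ℝ) < k := by exact_mod_cast NeZero.pos k
    positivity
  have hcard : ∀ U : Finset (ZMod k × ZMod k), (U.card : ℝ) ≤ (k : ℝ) ^ 2 := by
    intro U
    have := Finset.card_le_univ U
    rw [Fintype.card_prod, ZMod.card, ← sq] at this
    exact_mod_cast this
  set c : ℝ := Q.card / (k : ℝ) ^ 2 with hc
  have hc0 : 0 ≤ c := by positivity
  have hc1 : c ≤ 1 := by rw [hc, div_le_one hk]; exact hcard Q
  set f : ZMod k × ZMod k → ℝ := fun z => (if z ∈ Q then 1 else 0) - c with hf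
  have hmean : ∑ z, f z = 0 := by
    simp only [hf, Finset.sum_sub_distrib, Finset.sum_const, Finset.card_univ, Fintype.card_prod,
      ZMod.card, Finset.sum_boole, Finset.filter_univ_mem, nsmul_eq_mul, hc]
    push_cast
    have : (k : ℝ) ≠ 0 := NeZero.ne _
    field_simp
    simp
  have hnorm : ∑ z, f z ^ 2 ≤ (k : ℝ) ^ 2 := by
    calc ∑ z, f z ^ 2 ≤ ∑ z : ZMod k × ZMod k, (1 : ℝ) := by
          apply Finset.sum_le_sum
          intro z _
          simp only [hf]
          split_ifs <;> nlinarith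
      _ = _ := by simp [sq]
  have h1 : ((∑ j ∈ Finset.range (8 ^ t), (S.filter fun z => walk k t j z ∈ Q).card : ℕ) : ℝ) =
      8 ^ t * (∑ z ∈ S, average^[t] f z + S.card * c) := by
    have e : ∀ z, ∑ j ∈ Finset.range (8 ^ t), (if walk k t j z ∈ Q then (1 : ℝ) else 0) =
        8 ^ t * (average^[t] f z + c) := by
      intro z
      have := sum_walk t (fun z => if z ∈ Q then (1 : ℝ) else 0) z
      rw [this]
      have e2 : (fun z => if z ∈ Q then (1 : ℝ) else 0) = fun z => f z + c := by
        ext z; simp [hf]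
      rw [e2, iterate_average_add_const]
    push_cast
    simp only [Finset.card_filter]
    push_cast
    rw [Finset.sum_comm, Finset.sum_congr rfl fun z _ => e z, ← Finset.mul_sum,
      Finset.sum_add_distrib, Finset.sum_const, nsmul_eq_mul]
  -- Cauchy–Schwarz on `S`, then the contraction; `|S|` and the squared norm of `f` are each bounded
  -- by `k²`.
  have h2 : ∑ z ∈ S, average^[t] f z ≤ (73 / 80) ^ t * (k : ℝ) ^ 2 := by
    apply le_of_sq_le_sq _ (by positivity)
    calc (∑ z ∈ S, average^[t] f z) ^ 2 ≤ S.card * ∑ z ∈ S, average^[t] f z ^ 2 :=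
          sq_sum_le_card_mul_sum_sq
      _ ≤ (k : ℝ) ^ 2 * ∑ z, average^[t] f z ^ 2 := by
          gcongr
          · exact hcard S
          · exact Finset.subset_univ S
      _ ≤ (k : ℝ) ^ 2 * (((73 / 80) ^ t) ^ 2 * (k : ℝ) ^ 2) := by
          gcongr
          exact (sum_iterate_average_sq_le hmean t).trans (by gcongr)
      _ = _ := by ring
  rw [h1]
  have h3 : (S.card : ℝ) * c = S.card * Q.card / (k : ℝ) ^ 2 := by rw [hc]; ring
  rw [h3]
  have h4 : (0 : ℝ) < 8 ^ t := by positivity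
  nlinarith

end Torus

/-! ## The construction -/

namespace Torus

/-- A shear of pairs of natural numbers, modulo `k`. -/
def shearNat (k r : ℕ) (p : ℕ × ℕ) : ℕ × ℕ :=
  if 2 ≤ r then ((p.1 + (k - p.2) + (k - p.2) + (r - 2)) % k, p.2)
  else ((p.1 + p.2 + p.2 + r) % k, p.2)

/-- The maps `step` on representatives. -/
def stepNat (k r : ℕ) (p : ℕ × ℕ) : ℕ × ℕ :=
  if 4 ≤ r then (shearNat k (r - 4) p.swap).swap else shearNat k r p

/-- The maps `walk` on representatives. -/
def walkNat (k : ℕ) : ℕ → ℕ → ℕ × ℕ → ℕ × ℕ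
  | 0, _, p => p
  | t + 1, j, p => walkNat k t (j / 8) (stepNat k (j % 8) p)

/-- The image of `u < n` under the `j`-th of the `8 ^ t` permutations of `{0, …, n - 1}`. -/
def dest (n t j u : ℕ) : ℕ :=
  -- In this range `j` makes at least `n` full rounds modulo `n`; beyond it, `√n` is negligible
  -- against `n`.
  if n * n ≤ 8 ^ t then (u + j) % n
  else if u < n.sqrt * n.sqrt then
    (walkNat n.sqrt t j (u / n.sqrt, u % n.sqrt)).1 * n.sqrt +
      (walkNat n.sqrt t j (u / n.sqrt, u % n.sqrt)).2
  else u

variable {k : ℕ}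

lemma stepNat_lt [NeZero k] (r : ℕ) {p : ℕ × ℕ} (h1 : p.1 < k) (h2 : p.2 < k) :
    (stepNat k r p).1 < k ∧ (stepNat k r p).2 < k := by
  have := fun a => Nat.mod_lt a (NeZero.pos k)
  unfold stepNat shearNat
  split_ifs <;> simp [*]

lemma step_cast [NeZero k] {r : ℕ} (hr : r < 8) {p : ℕ × ℕ} (h1 : p.1 < k) (h2 : p.2 < k) :
    (((stepNat k r p).1 : ZMod k), ((stepNat k r p).2 : ZMod k)) = step k r (p.1, p.2) := by
  -- The truncated difference represents the negative because the coordinate is below `k`.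
  have e1 : ((k - p.1 : ℕ) : ZMod k) = -p.1 := by rw [Nat.cast_sub h1.le]; simp
  have e2 : ((k - p.2 : ℕ) : ZMod k) = -p.2 := by rw [Nat.cast_sub h2.le]; simp
  interval_cases r <;>
    simp [stepNat, shearNat, step, shearFst, shearSnd, ZMod.natCast_mod, e1, e2] <;> ring

lemma walkNat_lt [NeZero k] (t j : ℕ) {p : ℕ × ℕ} (h1 : p.1 < k) (h2 : p.2 < k) :
    (walkNat k t j p).1 < k ∧ (walkNat k t j p).2 < k := by
  induction t generalizing j p with
  | zero => exact ⟨h1, h2⟩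
  | succ t ih =>
    obtain ⟨h3, h4⟩ := stepNat_lt (j % 8) h1 h2
    exact ih _ h3 h4

lemma walk_cast [NeZero k] (t j : ℕ) {p : ℕ × ℕ} (h1 : p.1 < k) (h2 : p.2 < k) :
    (((walkNat k t j p).1 : ZMod k), ((walkNat k t j p).2 : ZMod k)) = walk k t j (p.1, p.2) := by
  induction t generalizing j p with
  | zero => rfl
  | succ t ih =>
    obtain ⟨h3, h4⟩ := stepNat_lt (j % 8) h1 h2
    rw [walkNat, ih _ h3 h4, step_cast (Nat.mod_lt _ (by norm_num)) h1 h2]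
    rfl

/-! ### Permutations of the left vertices -/

/-- The point of the torus numbered `u`. -/
def cell (k u : ℕ) : ZMod k × ZMod k := (((u / k : ℕ) : ZMod k), ((u % k : ℕ) : ZMod k))

lemma cell_injOn [NeZero k] {u v : ℕ} (hu : u < k * k) (hv : v < k * k)
    (h : cell k u = cell k v) : u = v := by
  have h1 := congrArg (fun z => ZMod.val z.1) h
  have h2 := congrArg (fun z => ZMod.val z.2) h
  simp only [cell] at h1 h2
  rw [ZMod.val_natCast_of_lt (Nat.div_lt_of_lt_mul hu),
    ZMod.val_natCast_of_lt (Nat.div_lt_of_lt_mul hv)] at h1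
  rw [ZMod.val_natCast_of_lt (Nat.mod_lt _ (NeZero.pos k)),
    ZMod.val_natCast_of_lt (Nat.mod_lt _ (NeZero.pos k))] at h2
  rw [← Nat.div_add_mod u k, ← Nat.div_add_mod v k, h1, h2]

lemma walkNat_div_mod [NeZero k] (t j : ℕ) {u : ℕ} (hu : u < k * k) :
    (walkNat k t j (u / k, u % k)).1 * k + (walkNat k t j (u / k, u % k)).2 < k * k ∧
      cell k ((walkNat k t j (u / k, u % k)).1 * k + (walkNat k t j (u / k, u % k)).2) =
        walk k t j (cell k u) := by
  have hk := NeZero.pos k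
  have h1 : (u / k, u % k).1 < k := Nat.div_lt_of_lt_mul hu
  have h2 : (u / k, u % k).2 < k := Nat.mod_lt _ hk
  have h3 := walk_cast t j h1 h2
  obtain ⟨h4, h5⟩ := walkNat_lt t j h1 h2
  generalize walkNat k t j (u / k, u % k) = q at *
  refine ⟨by nlinarith, ?_⟩
  rw [cell, cell, ← h3, mul_comm, Nat.mul_add_div hk, Nat.div_eq_of_lt h5, Nat.mul_add_mod,
    Nat.mod_eq_of_lt h5, add_zero]

lemma dest_lt {n : ℕ} (t j : ℕ) {u : ℕ} (hu : u < n) : dest n t j u < n := by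
  have : NeZero n.sqrt := ⟨by rw [Ne, Nat.sqrt_eq_zero]; omega⟩
  unfold dest
  split_ifs with h1 h2
  · exact Nat.mod_lt _ (by omega)
  · exact (walkNat_div_mod t j h2).1.trans_le (Nat.sqrt_le n)
  · exact hu

lemma dest_inj {n t j u v : ℕ} (hu : u < n) (hv : v < n) (h : dest n t j u = dest n t j v) :
    u = v := by
  have : NeZero n.sqrt := ⟨by rw [Ne, Nat.sqrt_eq_zero]; omega⟩
  unfold dest at h
  split_ifs at h with h1 h2 h3 h3
  · have h4 : u ≡ v [MOD n] := Nat.ModEq.add_right_cancel' j h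
    exact h4.eq_of_lt_of_lt hu hv
  · have e := congrArg (cell n.sqrt) h
    rw [(walkNat_div_mod t j h2).2, (walkNat_div_mod t j h3).2] at e
    exact cell_injOn h2 h3 ((walk _ t j).injective e)
  · have := (walkNat_div_mod t j h2).1
    omega
  · have := (walkNat_div_mod t j h3).1
    omega
  · exact h

/-- The map `dest` as a permutation. -/
noncomputable def destPerm (n t j : ℕ) : Equiv.Perm (Fin n) :=
  Equiv.ofBijective (fun u => ⟨dest n t j u, dest_lt t j u.2⟩) (Finite.injective_iff_bijective.1
    fun u v h => Fin.ext (dest_inj u.2 v.2 (congrArg Fin.val h)))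

lemma destPerm_val (n t j : ℕ) (u : Fin n) : (destPerm n t j u : ℕ) = dest n t j u := rfl

lemma cast_sub_sqrt_le (n : ℕ) : (n : ℝ) - (n.sqrt : ℝ) ^ 2 ≤ 2 * n.sqrt := by
  have h : n ≤ n.sqrt * n.sqrt + n.sqrt + n.sqrt := Nat.sqrt_le_add n
  have h' : (n : ℝ) ≤ n.sqrt * n.sqrt + n.sqrt + n.sqrt := by exact_mod_cast h
  linarith

/-- Both halves of `4√n` come from `n - k² ≤ 2√n`: once for the vertices of `S` outside the torus,
once for replacing `n` by `k²` in the density of `S`. -/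
lemma sum_card_dest_le_of_large {n t : ℕ} (h : 8 ^ t < n * n) {α : ℝ} (hα : 0 ≤ α) (hα1 : α ≤ 1)
    (S Q : Finset (Fin n)) (hS : (S.card : ℝ) ≤ α * n) :
    ((∑ j ∈ Finset.range (8 ^ t), (S.filter fun u => destPerm n t j u ∈ Q).card : ℕ) : ℝ) ≤
      8 ^ t * (α * Q.card + 4 * n.sqrt + (73 / 80) ^ t * n) := by
  have hn : 0 < n := by
    rcases Nat.eq_zero_or_pos n with h0 | h0
    · subst h0; simp at h
    · exact h0
  set k := n.sqrt with hk
  have : NeZero k := ⟨by rw [Ne, hk, Nat.sqrt_eq_zero]; omega⟩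
  have hkk : k * k ≤ n := Nat.sqrt_le n
  have hkn : (k : ℝ) ^ 2 ≤ n := by rw [sq]; exact_mod_cast hkk
  have hk0 : (0 : ℝ) < (k : ℝ) ^ 2 := by
    have : (0 : ℝ) < k := by exact_mod_cast NeZero.pos k
    positivity
  set core : Finset (Fin n) → Finset (ZMod k × ZMod k) := fun U =>
    (U.filter fun u : Fin n => (u : ℕ) < k * k).image (fun u : Fin n => cell k u) with hcore
  have hcard : ∀ U, (core U).card ≤ U.card := fun U =>
    Finset.card_image_le.trans (Finset.card_filter_le _ _)
  have hfew : (Finset.univ.filter fun u : Fin n => ¬ (u : ℕ) < k * k).card = n - k * k := by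
    rw [Finset.filter_not, Finset.card_sdiff_of_subset (Finset.filter_subset _ _), Finset.card_univ,
      Fintype.card_fin, Fin.card_filter_val_lt, min_eq_right hkk]
  have h1 : ∀ j, (S.filter fun u => destPerm n t j u ∈ Q).card ≤
      (n - k * k) + ((core S).filter fun z => walk k t j z ∈ core Q).card := by
    intro j
    rw [← Finset.card_filter_add_card_filter_not (s := S.filter fun u => destPerm n t j u ∈ Q)
      (fun u => (u : ℕ) < k * k), add_comm]
    apply add_le_add
    · rw [← hfew]
      exact Finset.card_le_card fun u hu => by
        simp only [Finset.mem_filter, Finset.mem_univ, true_and] at hu ⊢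
        exact hu.2
    · apply Finset.card_le_card_of_injOn (fun u : Fin n => cell k u)
      · intro u hu
        simp only [Finset.coe_filter, Finset.mem_filter, Set.mem_ofPred_eq] at hu
        obtain ⟨⟨hu1, hu2⟩, hu3⟩ := hu
        have h4 := walkNat_div_mod t j hu3
        have h5 : (destPerm n t j u : ℕ) = (walkNat k t j (u / k, u % k)).1 * k +
            (walkNat k t j (u / k, u % k)).2 := by
          rw [destPerm_val, dest, if_neg (not_le.2 h), if_pos hu3]
        rw [← h5] at h4
        simp only [Finset.coe_filter, Set.mem_ofPred_eq, hcore, Finset.mem_image,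
          Finset.mem_filter]
        exact ⟨⟨u, ⟨hu1, hu3⟩, rfl⟩, ⟨_, ⟨hu2, h4.1⟩, h4.2⟩⟩
      · intro u hu v hv huv
        simp only [Finset.coe_filter, Finset.mem_filter, Set.mem_ofPred_eq] at hu hv
        exact Fin.ext (cell_injOn hu.2 hv.2 huv)
  have h2 : ((∑ j ∈ Finset.range (8 ^ t), (S.filter fun u => destPerm n t j u ∈ Q).card : ℕ) : ℝ) ≤
      8 ^ t * ((n : ℝ) - (k : ℝ) ^ 2) + ((∑ j ∈ Finset.range (8 ^ t),
        ((core S).filter fun z => walk k t j z ∈ core Q).card : ℕ) : ℝ) := by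
    have h3 := Finset.sum_le_sum fun j (_ : j ∈ Finset.range (8 ^ t)) => h1 j
    rw [Finset.sum_add_distrib, Finset.sum_const, Finset.card_range, smul_eq_mul] at h3
    refine (Nat.cast_le.2 h3).trans (le_of_eq ?_)
    push_cast [Nat.cast_sub hkk]
    ring
  have h3 := sum_card_walk_le t (core S) (core Q)
  have h4 := cast_sub_sqrt_le n
  rw [← hk] at h4
  have h5 : ((core S).card : ℝ) * (core Q).card / (k : ℝ) ^ 2 ≤ α * Q.card + ((n : ℝ) - k ^ 2) := by
    have h6 : ((core S).card : ℝ) ≤ α * n := le_trans (by exact_mod_cast hcard S) hS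
    have h7 : ((core Q).card : ℝ) ≤ Q.card := by exact_mod_cast hcard Q
    have h8 : ((core Q).card : ℝ) ≤ (k : ℝ) ^ 2 := by
      have := Finset.card_le_univ (core Q)
      rw [Fintype.card_prod, ZMod.card, ← sq] at this
      exact_mod_cast this
    rw [div_le_iff₀ hk0]
    calc ((core S).card : ℝ) * (core Q).card ≤ α * n * (core Q).card := by gcongr
      _ = α * (core Q).card * k ^ 2 + α * ((n - k ^ 2) * (core Q).card) := by ring
      _ ≤ α * Q.card * k ^ 2 + 1 * ((n - k ^ 2) * k ^ 2) := by
        have : (0 : ℝ) ≤ n - (k : ℝ) ^ 2 := by linarith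
        gcongr
      _ = _ := by ring
  have h6 : (73 / 80 : ℝ) ^ t * (k : ℝ) ^ 2 ≤ (73 / 80 : ℝ) ^ t * n := by gcongr
  refine h2.trans ?_
  refine (add_le_add_right h3 _).trans ?_
  rw [← mul_add]
  exact mul_le_mul_of_nonneg_left (by linarith) (by positivity)

/-- For given `u` and `z`, the shift `j` is determined modulo `n`. -/
lemma sum_card_dest_le_of_small {n t : ℕ} (h : n * n ≤ 8 ^ t) (S Q : Finset (Fin n)) :
    (∑ j ∈ Finset.range (8 ^ t), (S.filter fun u => destPerm n t j u ∈ Q).card) ≤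
      S.card * Q.card * (8 ^ t / n + 1) := by
  have h1 : ∀ u z : Fin n, ((Finset.range (8 ^ t)).filter fun j => destPerm n t j u = z).card ≤
      8 ^ t / n + 1 := by
    intro u z
    have hn : 0 < n := u.pos
    have h2 : ((Finset.range (8 ^ t)).filter fun j => destPerm n t j u = z) ⊆
        (Finset.range (8 ^ t)).filter fun j => j ≡ z + (n - u) [MOD n] := by
      intro j hj
      simp only [Finset.mem_filter, Fin.ext_iff, destPerm_val, dest, if_pos h] at hj ⊢
      refine ⟨hj.1, ?_⟩
      have h3 : (u + j) ≡ z [MOD n] := by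
        rw [Nat.ModEq, hj.2, Nat.mod_eq_of_lt z.2]
      have h4 := h3.add_right (n - u)
      have h5 : (u : ℕ) + j + (n - u) = j + n := by omega
      rw [h5] at h4
      exact (Nat.add_modEq_right.symm).trans h4
    refine (Finset.card_le_card h2).trans ?_
    rw [← Nat.count_eq_card_filter_range, Nat.count_modEq_card _ hn]
    split_ifs <;> omega
  calc _ = ∑ j ∈ Finset.range (8 ^ t), ∑ u ∈ S, ∑ z ∈ Q, if destPerm n t j u = z then 1 else 0 := by
        refine Finset.sum_congr rfl fun j _ => ?_
        rw [Finset.card_filter]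
        refine Finset.sum_congr rfl fun u _ => ?_
        rw [Finset.sum_ite_eq]
    _ = ∑ u ∈ S, ∑ z ∈ Q, ((Finset.range (8 ^ t)).filter fun j => destPerm n t j u = z).card := by
        rw [Finset.sum_comm]
        refine Finset.sum_congr rfl fun u _ => ?_
        rw [Finset.sum_comm]
        refine Finset.sum_congr rfl fun z _ => ?_
        rw [Finset.card_filter]
    _ ≤ ∑ u ∈ S, ∑ z ∈ Q, (8 ^ t / n + 1) :=
        Finset.sum_le_sum fun u _ => Finset.sum_le_sum fun z _ => h1 u z
    _ = _ := by simp [mul_assoc]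

/-! ### The graph: degrees and overloaded vertices -/

/-- The list of edges in the order in which the algorithm writes them. -/
def edgeList (n m t : ℕ) (hm : 0 < m) : List (Fin n × Fin m) :=
  (List.finRange n).flatMap fun u => (List.range (8 ^ t)).map fun j =>
    (u, ⟨dest n t j u % m, Nat.mod_lt _ hm⟩)

/-- The multigraph with these edges. -/
def graph (n m t : ℕ) (hm : 0 < m) : BipMultigraph n m := ⟨edgeList n m t hm⟩

variable {n m t : ℕ} (hm : 0 < m)

lemma countP_graph (P : Fin n × Fin m → Prop) [DecidablePred P] :
    (graph n m t hm).edges.countP P = ∑ u : Fin n, ((Finset.range (8 ^ t)).filter fun j =>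
      P (u, ⟨destPerm n t j u % m, Nat.mod_lt _ hm⟩)).card := by
  rw [graph, Multiset.coe_countP, edgeList, List.countP_flatMap, Fin.sum_univ_def]
  congr 1
  refine List.map_congr_left fun u _ => ?_
  rw [Function.comp_apply, List.countP_map, ← Nat.count_eq_card_filter_range, Nat.count]
  rfl

lemma card_edges_graph : (graph n m t hm).edges.card = n * 8 ^ t := by
  have := countP_graph (n := n) (t := t) hm (fun _ => True)
  simpa using this

lemma leftDegree_graph (u : Fin n) : (graph n m t hm).leftDegree u = 8 ^ t := by
  rw [BipMultigraph.leftDegree, countP_graph, Finset.sum_eq_single u]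
  · simp
  · intro v _ hv
    simp [hv]
  · simp

lemma degreeFrom_graph (S : Finset (Fin n)) (v : Fin m) :
    (graph n m t hm).degreeFrom S v =
      ∑ j ∈ Finset.range (8 ^ t), (S.filter fun u => (destPerm n t j u : ℕ) % m = v).card := by
  rw [BipMultigraph.degreeFrom, countP_graph]
  simp only [Finset.card_filter, Fin.ext_iff]
  rw [Finset.sum_comm]
  refine Finset.sum_congr rfl fun j _ => ?_
  rw [← Finset.sum_filter_add_sum_filter_not Finset.univ (fun u => u ∈ S)]
  rw [Finset.filter_univ_mem, Finset.sum_eq_zero (s := Finset.univ.filter _), add_zero]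
  · exact Finset.sum_congr rfl fun u hu => by simp [hu]
  · intro u hu
    simp only [Finset.mem_filter, Finset.mem_univ, true_and] at hu
    simp [hu]

lemma rightDegree_graph (v : Fin m) : (graph n m t hm).rightDegree v =
    8 ^ t * (Finset.univ.filter fun z : Fin n => (z : ℕ) % m = v).card := by
  have h : (graph n m t hm).rightDegree v = (graph n m t hm).degreeFrom Finset.univ v := by
    simp [BipMultigraph.rightDegree, BipMultigraph.degreeFrom]
  rw [h, degreeFrom_graph]
  have h2 : ∀ j, (Finset.univ.filter fun u => (destPerm n t j u : ℕ) % m = v).card =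
      (Finset.univ.filter fun z : Fin n => (z : ℕ) % m = v).card := by
    intro j
    rw [Finset.card_filter, Finset.card_filter]
    exact Equiv.sum_comp (destPerm n t j) fun z : Fin n => if (z : ℕ) % m = v then 1 else 0
  simp [h2]

/-- A residue class has `⌊n/m⌋` elements or one more, and `⌊n/m⌋ ≥ 1`. -/
lemma card_fiber_bounds (hmn : m ≤ n) (v : Fin m) :
    n / m ≤ (Finset.univ.filter fun z : Fin n => (z : ℕ) % m = v).card ∧
      (Finset.univ.filter fun z : Fin n => (z : ℕ) % m = v).card ≤ 2 * (n / m) := by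
  have hm : 0 < m := v.pos
  have h1 : 1 ≤ n / m := (Nat.one_le_div_iff hm).2 hmn
  have h : (Finset.univ.filter fun z : Fin n => (z : ℕ) % m = v).card =
      Nat.count (· ≡ v [MOD m]) n := by
    rw [Nat.count_eq_card_filter_range, Finset.card_filter, Finset.card_filter,
      Finset.sum_range]
    simp only [Nat.ModEq, Nat.mod_eq_of_lt v.2]
  rw [h, Nat.count_modEq_card _ hm]
  split_ifs <;> omega

/-- The left vertices that, as numbers, reduce modulo `m` to an element of `Q`. -/
def lift (n : ℕ) (Q : Finset (Fin m)) : Finset (Fin n) :=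
  Finset.univ.filter fun z => ∃ v ∈ Q, (z : ℕ) % m = v

lemma sum_card_fiber (A : Finset (Fin n)) (f : Fin n → Fin n) (Q : Finset (Fin m)) :
    ∑ v ∈ Q, (A.filter fun u => (f u : ℕ) % m = v).card =
      (A.filter fun u => f u ∈ lift n Q).card := by
  rw [← Finset.card_biUnion]
  · congr 1
    ext u
    simp only [Finset.mem_biUnion, Finset.mem_filter, lift, Finset.mem_univ, true_and]
    tauto
  · intro v _ w _ hvw
    rw [Function.onFun, Finset.disjoint_filter]
    intro u _ h1 h2
    exact hvw (Fin.ext (h1.symm.trans h2))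

lemma card_lift (Q : Finset (Fin m)) : ∑ v ∈ Q,
    (Finset.univ.filter fun z : Fin n => (z : ℕ) % m = v).card = (lift n Q).card := by
  have h := sum_card_fiber (Finset.univ : Finset (Fin n)) id Q
  simpa using h

/-- The overload inequalities are summed over `Q`; both degree sums become counts over the preimage
of `Q`. -/
lemma mul_card_lift_lt {β : ℝ} {S : Finset (Fin n)}
    (hQ : ((graph n m t hm).overloaded β S).Nonempty) :
    β * (8 ^ t * (lift n ((graph n m t hm).overloaded β S)).card) <
      ((∑ j ∈ Finset.range (8 ^ t), (S.filter fun u => destPerm n t j u ∈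
        lift n ((graph n m t hm).overloaded β S)).card : ℕ) : ℝ) := by
  set Q := (graph n m t hm).overloaded β S with hQd
  have h1 : ∑ v ∈ Q, β * ((graph n m t hm).rightDegree v : ℝ) <
      ∑ v ∈ Q, ((graph n m t hm).degreeFrom S v : ℝ) := by
    apply Finset.sum_lt_sum_of_nonempty hQ
    intro v hv
    rw [hQd, BipMultigraph.overloaded, Finset.mem_filter] at hv
    exact hv.2
  rw [← Finset.mul_sum, ← Nat.cast_sum, ← Nat.cast_sum] at h1
  simp only [rightDegree_graph, degreeFrom_graph] at h1
  rw [← Finset.mul_sum, card_lift, Finset.sum_comm] at h1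
  simp only [sum_card_fiber] at h1
  exact_mod_cast h1

lemma le_card_lift (hm : 0 < m) (hmn : m ≤ n) (Q : Finset (Fin m)) :
    (Q.card : ℝ) * n ≤ 2 * m * (lift n Q).card := by
  have h1 : Q.card * (n / m) ≤ (lift n Q).card := by
    rw [← card_lift, ← smul_eq_mul]
    exact Finset.card_nsmul_le_sum _ _ _ fun v _ => (card_fiber_bounds hmn v).1
  have h2 : n ≤ 2 * m * (n / m) := by
    have := Nat.div_add_mod n m
    have := Nat.mod_lt n hm
    have h3 : 1 ≤ n / m := (Nat.one_le_div_iff hm).2 hmn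
    nlinarith
  have h3 : Q.card * n ≤ 2 * m * (lift n Q).card := by
    calc Q.card * n ≤ Q.card * (2 * m * (n / m)) := Nat.mul_le_mul_left _ h2
      _ = 2 * m * (Q.card * (n / m)) := by ring
      _ ≤ _ := Nat.mul_le_mul_left _ h1
  exact_mod_cast h3

/-- The base `11/12` dominates both errors: `73/80 < 11/12`, and `√n ≤ (11/12)^t n` for large `n`.
Together they are at most `5 (11/12)^t n ≤ (β - α) μn/2 ≤ (β - α)|L|`. -/
theorem card_overloaded_lt (hmn : m ≤ n) {α β μ : ℝ} (hα : 0 < α) (hαβ : α < β) (hβ : β < 1)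
    (hμ : 0 < μ) (ht : 10 * (11 / 12 : ℝ) ^ t ≤ (β - α) * μ) (ht' : (11 / 12 : ℝ) ^ t ≤ β - α)
    (S : Finset (Fin n)) (hS : (S.card : ℝ) ≤ α * n) :
    (((graph n m t hm).overloaded β S).card : ℝ) < μ * m := by
  have hm' : (0 : ℝ) < m := by exact_mod_cast hm
  have hn : 0 < n := by omega
  have hn' : (0 : ℝ) < n := by exact_mod_cast hn
  by_contra! hc
  have hne : ((graph n m t hm).overloaded β S).Nonempty := by
    rw [← Finset.card_pos]
    have : (0 : ℝ) < ((graph n m t hm).overloaded β S).card := by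
      have : 0 < μ * m := by positivity
      linarith
    exact_mod_cast this
  have h1 := mul_card_lift_lt hm hne
  have h2 := le_card_lift hm hmn ((graph n m t hm).overloaded β S)
  generalize lift n ((graph n m t hm).overloaded β S) = L at h1 h2
  have h3 : μ * n ≤ 2 * L.card := by
    have : m * (μ * n) ≤ m * (2 * L.card) := by nlinarith
    exact le_of_mul_le_mul_left this hm'
  have hL : (0 : ℝ) < L.card := by
    have : 0 < μ * n := by positivity
    linarith
  have h8 : (0 : ℝ) < 8 ^ t := by positivity
  have hδ : 0 < β - α := by linarith
  rcases le_or_gt (n * n) (8 ^ t) with h | h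
  · have h4 : ((∑ j ∈ Finset.range (8 ^ t), (S.filter fun u => destPerm n t j u ∈ L).card : ℕ) : ℝ)
        ≤ S.card * L.card * (8 ^ t / n + 1) := by
      refine (Nat.cast_le.2 (sum_card_dest_le_of_small h S L)).trans ?_
      push_cast
      gcongr
      have := @Nat.cast_div_le ℝ _ _ _ (8 ^ t) n
      push_cast at this
      exact this
    have h5 : (S.card : ℝ) * L.card * (8 ^ t / n + 1) ≤ α * n * L.card * (8 ^ t / n + 1) := by
      gcongr
    have h6 : α * n * L.card * (8 ^ t / n + 1) = (α * (8 ^ t + n)) * L.card := by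
      field_simp
    have h7 : β * 8 ^ t < α * (8 ^ t + n) := by
      have : (β * 8 ^ t) * L.card < (α * (8 ^ t + n)) * L.card := by linarith
      exact lt_of_mul_lt_mul_right this hL.le
    have h9 : (β - α) * 8 ^ t < n := by nlinarith
    have h10 : (n : ℝ) * n ≤ 8 ^ t := by exact_mod_cast h
    -- Squaring and using `n² ≤ 8^t` gives `(β - α)² 8^t < 1`, against `(11/12)^(2t) 8^t ≥ 1`.
    have h11 : ((β - α) * 8 ^ t) * ((β - α) * 8 ^ t) < 8 ^ t := by
      have : 0 < (β - α) * 8 ^ t := by positivity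
      nlinarith
    have h12 : (β - α) ^ 2 * 8 ^ t < 1 := by
      have : ((β - α) ^ 2 * 8 ^ t) * 8 ^ t < 1 * 8 ^ t := by linarith
      exact lt_of_mul_lt_mul_right this h8.le
    have h13 : (1 : ℝ) ≤ ((11 / 12 : ℝ) ^ t) ^ 2 * 8 ^ t := by
      rw [← pow_mul, mul_comm t, pow_mul, ← mul_pow]
      exact one_le_pow₀ (by norm_num)
    have h14 : ((11 / 12 : ℝ) ^ t) ^ 2 ≤ (β - α) ^ 2 := by gcongr
    nlinarith
  · have h4 := sum_card_dest_le_of_large h hα.le (by linarith) S L hS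
    have h5 : β * L.card < α * L.card + 4 * n.sqrt + (73 / 80) ^ t * n := by
      have := h1.trans_le h4
      have : 8 ^ t * (β * L.card) < 8 ^ t * (α * L.card + 4 * n.sqrt + (73 / 80) ^ t * n) := by
        linarith
      exact lt_of_mul_lt_mul_left this h8.le
    have h6 : (73 / 80 : ℝ) ^ t ≤ (11 / 12) ^ t :=
      pow_le_pow_left₀ (by norm_num) (by norm_num) t
    -- From `n² > 8^t` follows `√n ≤ 8^(-t/4) n`, and `8^(-1/4) < 11/12`; the fourth power avoids
    -- roots.
    have h7 : (n.sqrt : ℝ) ≤ (11 / 12) ^ t * n := by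
      have h9 : (n.sqrt : ℝ) ^ 2 ≤ n := by
        have := Nat.sqrt_le n
        rw [sq]; exact_mod_cast this
      have h10 : (1 : ℝ) ≤ ((11 / 12 : ℝ) ^ t) ^ 4 * 8 ^ t := by
        rw [← pow_mul, mul_comm t, pow_mul, ← mul_pow]
        exact one_le_pow₀ (by norm_num)
      have h11 : (8 : ℝ) ^ t ≤ n ^ 2 := by
        rw [sq]; exact_mod_cast h.le
      refine le_of_pow_le_pow_left₀ (n := 4) (by norm_num) (by positivity) ?_
      calc (n.sqrt : ℝ) ^ 4 = ((n.sqrt : ℝ) ^ 2) ^ 2 := by ring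
        _ ≤ 1 * (n : ℝ) ^ 2 := by rw [one_mul]; gcongr
        _ ≤ (((11 / 12 : ℝ) ^ t) ^ 4 * 8 ^ t) * (n : ℝ) ^ 2 := by gcongr
        _ ≤ (((11 / 12 : ℝ) ^ t) ^ 4 * (n : ℝ) ^ 2) * (n : ℝ) ^ 2 := by gcongr
        _ = _ := by ring
    have h9 : (73 / 80 : ℝ) ^ t * n ≤ (11 / 12) ^ t * n := by gcongr
    have h10 : (β - α) * (μ * n) ≤ (β - α) * (2 * L.card) := by gcongr
    have h11 : 10 * (11 / 12 : ℝ) ^ t * n ≤ (β - α) * μ * n := by gcongr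
    nlinarith

end Torus

/-! ## The algorithm -/

namespace RAM

open Program

local infixr:60 " ;; " => Program.seq

/-! ### Total correctness with running time -/

/-- The program `p` can be run from `s`, ending in a state and after a time that satisfy `Q`. -/
def Reaches (p : Program) (Q : State → ℕ → Prop) (s : State) : Prop :=
  ∃ s' t, Exec p s s' t ∧ Q s' t

lemma Reaches.mono {p : Program} {Q Q' : State → ℕ → Prop} {s : State} (h : Reaches p Q s)
    (hQ : ∀ s' t, Q s' t → Q' s' t) : Reaches p Q' s := by
  obtain ⟨s', t, h1, h2⟩ := h
  exact ⟨s', t, h1, hQ _ _ h2⟩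

/-- The rules for single instructions are equivalences, so that `simp` can execute straight-line
code symbolically. -/
lemma reaches_skip {Q : State → ℕ → Prop} {s : State} : Reaches skip Q s ↔ Q s 1 :=
  ⟨by rintro ⟨_, _, h, hQ⟩; cases h; exact hQ, fun h => ⟨_, _, .skip _, h⟩⟩

lemma reaches_const {Q : State → ℕ → Prop} {s : State} {x a : ℕ} :
    Reaches (const x a) Q s ↔ Q (s.set x a) 1 :=
  ⟨by rintro ⟨_, _, h, hQ⟩; cases h; exact hQ, fun h => ⟨_, _, .const _ _ _, h⟩⟩

lemma reaches_copy {Q : State → ℕ → Prop} {s : State} {x y : ℕ} :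
    Reaches (copy x y) Q s ↔ Q (s.set x (s.reg y)) 1 :=
  ⟨by rintro ⟨_, _, h, hQ⟩; cases h; exact hQ, fun h => ⟨_, _, .copy _ _ _, h⟩⟩

lemma reaches_add {Q : State → ℕ → Prop} {s : State} {x y z : ℕ} :
    Reaches (add x y z) Q s ↔ Q (s.set x (s.reg y + s.reg z)) 1 :=
  ⟨by rintro ⟨_, _, h, hQ⟩; cases h; exact hQ, fun h => ⟨_, _, .add _ _ _ _, h⟩⟩

lemma reaches_sub {Q : State → ℕ → Prop} {s : State} {x y z : ℕ} :
    Reaches (sub x y z) Q s ↔ Q (s.set x (s.reg y - s.reg z)) 1 :=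
  ⟨by rintro ⟨_, _, h, hQ⟩; cases h; exact hQ, fun h => ⟨_, _, .sub _ _ _ _, h⟩⟩

lemma reaches_write {Q : State → ℕ → Prop} {s : State} {x : ℕ} :
    Reaches (write x) Q s ↔ Q { s with out := s.out ++ [s.reg x] } 1 :=
  ⟨by rintro ⟨_, _, h, hQ⟩; cases h; exact hQ, fun h => ⟨_, _, .write _ _, h⟩⟩

lemma reaches_seq {Q : State → ℕ → Prop} {s : State} {p q : Program} :
    Reaches (p ;; q) Q s ↔
      Reaches p (fun s' t => Reaches q (fun s'' t' => Q s'' (t + t')) s') s := by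
  constructor
  · rintro ⟨_, _, h, hQ⟩
    cases h with
    | seq h1 h2 => exact ⟨_, _, h1, _, _, h2, hQ⟩
  · rintro ⟨_, _, h1, _, _, h2, hQ⟩
    exact ⟨_, _, .seq h1 h2, hQ⟩

lemma reaches_ite {Q : State → ℕ → Prop} {s : State} {x : ℕ} {p q : Program} :
    Reaches (ite x p q) Q s ↔
      if s.reg x ≠ 0 then Reaches p (fun s' t => Q s' (t + 1)) s
      else Reaches q (fun s' t => Q s' (t + 1)) s := by
  constructor
  · rintro ⟨_, _, h, hQ⟩
    cases h with
    | ite_true h1 h2 => rw [if_pos h1]; exact ⟨_, _, h2, hQ⟩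
    | ite_false h1 h2 => rw [if_neg (not_not.2 h1)]; exact ⟨_, _, h2, hQ⟩
  · intro h
    split_ifs at h with h1
    · obtain ⟨_, _, h2, hQ⟩ := h
      exact ⟨_, _, .ite_true h1 h2, hQ⟩
    · obtain ⟨_, _, h2, hQ⟩ := h
      exact ⟨_, _, .ite_false (not_not.1 h1) h2, hQ⟩

/-- The invariant is indexed by the completed passes, and their number `c` is fixed beforehand; this
yields termination and the time bound together. -/
lemma reaches_loop {x : ℕ} {p : Program} {I : ℕ → State → Prop} {c T : ℕ}
    (hstep : ∀ i < c, ∀ s, I i s → s.reg x ≠ 0 ∧ Reaches p (fun s' t => I (i + 1) s' ∧ t ≤ T) s)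
    (hend : ∀ s, I c s → s.reg x = 0) {s : State} (hs : I 0 s) :
    Reaches (loop x p) (fun s' t => I c s' ∧ t ≤ c * (T + 1) + 1) s := by
  suffices h : ∀ d, ∀ i s, i + d = c → I i s →
      Reaches (loop x p) (fun s' t => I c s' ∧ t ≤ d * (T + 1) + 1) s from
    h c 0 s (by omega) hs
  intro d
  induction d with
  | zero =>
    intro i s hi h
    obtain rfl : i = c := by omega
    exact ⟨s, 1, .loop_false (hend _ h), h, by omega⟩
  | succ d ih =>
    intro i s hi h
    obtain ⟨h1, s', t, h2, h3, h4⟩ := hstep i (by omega) s h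
    obtain ⟨s'', t', h5, h6, h7⟩ := ih (i + 1) s' (by omega) h3
    refine ⟨s'', _, .loop_true h1 h2 h5, h6, ?_⟩
    rw [add_mul, one_mul]
    omega

/-! ### Register layout -/

/-- The contents of the registers that hold the input, the parameters, the loop counters, and the
output. -/
structure Main where
  (n m D k N f a u b j : ℕ)
  (out : List ℕ)

/-- The contents of the registers for intermediate results. -/
structure Temp where
  (x y i c e A B C E : ℕ)

/-- The state whose registers are given by a list. -/
def ofList (l o : List ℕ) : State := ⟨fun i => l.getD i 0, o⟩

lemma ofList_set {l o : List ℕ} {x a : ℕ} (h : x < l.length) :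
    (ofList l o).set x a = ofList (l.set x a) o := by
  unfold State.set ofList
  congr 1
  funext i
  by_cases hi : i = x
  · subst hi
    simp [h]
  · simp [Function.update_of_ne hi, List.getElem?_set_ne (Ne.symm hi)]

/-- The state with the given contents; the register `3` holds `1`. -/
def state (r : Main) (w : Temp) : State :=
  ofList [r.n, r.m, r.D, 1, r.k, r.N, r.f, r.a, r.u, r.b, r.j, w.x, w.y, w.i, w.c, w.e, w.A, w.B,
    w.C, w.E] r.out

section
variable (r : Main) (w : Temp) (z : ℕ)

lemma reg_n : (state r w).reg 0 = r.n := rfl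
lemma reg_m : (state r w).reg 1 = r.m := rfl
lemma reg_D : (state r w).reg 2 = r.D := rfl
lemma reg_one : (state r w).reg 3 = 1 := rfl
lemma reg_k : (state r w).reg 4 = r.k := rfl
lemma reg_N : (state r w).reg 5 = r.N := rfl
lemma reg_f : (state r w).reg 6 = r.f := rfl
lemma reg_a : (state r w).reg 7 = r.a := rfl
lemma reg_u : (state r w).reg 8 = r.u := rfl
lemma reg_b : (state r w).reg 9 = r.b := rfl
lemma reg_j : (state r w).reg 10 = r.j := rfl
lemma reg_x : (state r w).reg 11 = w.x := rfl
lemma reg_y : (state r w).reg 12 = w.y := rfl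
lemma reg_i : (state r w).reg 13 = w.i := rfl
lemma reg_c : (state r w).reg 14 = w.c := rfl
lemma reg_e : (state r w).reg 15 = w.e := rfl
lemma reg_A : (state r w).reg 16 = w.A := rfl
lemma reg_B : (state r w).reg 17 = w.B := rfl
lemma reg_C : (state r w).reg 18 = w.C := rfl
lemma reg_E : (state r w).reg 19 = w.E := rfl

lemma set_k : (state r w).set 4 z = state { r with k := z } w := ofList_set (by simp)
lemma set_N : (state r w).set 5 z = state { r with N := z } w := ofList_set (by simp)
lemma set_f : (state r w).set 6 z = state { r with f := z } w := ofList_set (by simp)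
lemma set_a : (state r w).set 7 z = state { r with a := z } w := ofList_set (by simp)
lemma set_u : (state r w).set 8 z = state { r with u := z } w := ofList_set (by simp)
lemma set_b : (state r w).set 9 z = state { r with b := z } w := ofList_set (by simp)
lemma set_j : (state r w).set 10 z = state { r with j := z } w := ofList_set (by simp)
lemma set_x : (state r w).set 11 z = state r { w with x := z } := ofList_set (by simp)
lemma set_y : (state r w).set 12 z = state r { w with y := z } := ofList_set (by simp)
lemma set_i : (state r w).set 13 z = state r { w with i := z } := ofList_set (by simp)
lemma set_c : (state r w).set 14 z = state r { w with c := z } := ofList_set (by simp)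
lemma set_e : (state r w).set 15 z = state r { w with e := z } := ofList_set (by simp)
lemma set_A : (state r w).set 16 z = state r { w with A := z } := ofList_set (by simp)
lemma set_B : (state r w).set 17 z = state r { w with B := z } := ofList_set (by simp)
lemma set_C : (state r w).set 18 z = state r { w with C := z } := ofList_set (by simp)
lemma set_E : (state r w).set 19 z = state r { w with E := z } := ofList_set (by simp)

end

/-- Division with remainder of register `16` by register `17`; the quotient goes to register `18`
and the remainder to register `16`. -/
def divMod : Program :=
  const 18 0 ;; add 19 16 3 ;; sub 19 19 17 ;;
    loop 19 (add 18 18 3 ;; sub 16 16 17 ;; add 19 16 3 ;; sub 19 19 17)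

/-- Truncated subtraction serves as comparison: `A + 1 - B` is nonzero exactly when `B ≤ A`. -/
lemma reaches_divMod {Q : State → ℕ → Prop} {r : Main} {w : Temp} (hB : 0 < w.B)
    (h : ∀ t ≤ 5 * w.A + 4,
      Q (state r { w with A := w.A % w.B, C := w.A / w.B, E := 0 }) t) :
    Reaches divMod Q (state r w) := by
  have hm : ∀ i, i ≤ w.A / w.B → i * w.B ≤ w.A := fun i hi =>
    (Nat.mul_le_mul_right _ hi).trans (Nat.div_mul_le_self _ _)
  have hlt : w.A < w.A / w.B * w.B + w.B := Nat.lt_div_mul_add hB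
  have hmod : w.A - w.A / w.B * w.B = w.A % w.B := by
    have := Nat.div_add_mod' w.A w.B
    omega
  have hle : w.A / w.B ≤ w.A := Nat.div_le_self _ _
  simp only [divMod, reaches_seq, reaches_const, reaches_add, reaches_sub, set_C, set_E, reg_A,
    reg_B, reg_E, reg_one]
  refine (reaches_loop (c := w.A / w.B) (T := 4) (I := fun i s => s = state r { w with
    A := w.A - i * w.B, C := i, E := w.A - i * w.B + 1 - w.B }) ?_ ?_ ?_).mono ?_
  · rintro i hi s rfl
    have h1 := hm (i + 1) hi
    rw [add_mul, one_mul] at h1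
    simp only [reaches_seq, reaches_add, reaches_sub, set_C, set_E, set_A, reg_C, reg_A, reg_B,
      reg_E, reg_one]
    refine ⟨by omega, ?_, by norm_num⟩
    rw [Nat.sub_sub, add_mul, one_mul]
  · rintro s rfl
    rw [reg_E]
    simp only
    omega
  · simp
  · rintro s t ⟨rfl, ht⟩
    have hE : w.A - w.A / w.B * w.B + 1 - w.B = 0 := by omega
    rw [hE, hmod]
    apply h
    omega

/-! ### Arithmetic subroutines and the walk -/

/-- The product of the registers `16` and `17` goes to register `18`. -/
def mul : Program :=
  const 18 0 ;; loop 16 (add 18 18 17 ;; sub 16 16 3)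

lemma reaches_mul {Q : State → ℕ → Prop} {r : Main} {w : Temp}
    (h : ∀ t ≤ 3 * w.A + 2, Q (state r { w with A := 0, C := w.A * w.B }) t) :
    Reaches mul Q (state r w) := by
  simp only [mul, reaches_seq, reaches_const, set_C]
  refine (reaches_loop (c := w.A) (T := 2) (I := fun i s => s = state r { w with
    A := w.A - i, C := i * w.B }) ?_ ?_ ?_).mono ?_
  · rintro i hi s rfl
    simp only [reaches_seq, reaches_add, reaches_sub, set_C, set_A, reg_C, reg_A, reg_B, reg_one]
    refine ⟨by omega, ?_, by norm_num⟩
    rw [Nat.sub_sub, add_mul, one_mul]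
  · rintro s rfl
    simp [reg_A]
  · simp
  · rintro s t ⟨rfl, ht⟩
    rw [Nat.sub_self]
    apply h
    omega

/-- The integer square root of `n` goes to register `4`, and its square to register `5`. -/
def sqrt : Program :=
  const 4 0 ;; const 5 0 ;; copy 19 0 ;;
    loop 19 (add 5 5 4 ;; add 5 5 4 ;; add 5 5 3 ;; add 4 4 3 ;; add 18 5 4 ;; add 18 18 4 ;;
      sub 19 0 18)

/-- The test `n - (k² + 2k)` is nonzero exactly when `(k + 1)² ≤ n`; adding `2k + 1` updates the
square. -/
lemma reaches_sqrt {Q : State → ℕ → Prop} {r : Main} {w : Temp}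
    (h : ∀ w', ∀ t ≤ 8 * r.n + 4,
      Q (state { r with k := r.n.sqrt, N := r.n.sqrt * r.n.sqrt } w') t) :
    Reaches sqrt Q (state r w) := by
  have hle : r.n.sqrt ≤ r.n := Nat.sqrt_le_self _
  simp only [sqrt, reaches_seq, reaches_const, reaches_copy, set_k, set_N, set_E, reg_n]
  refine (reaches_loop (c := r.n.sqrt) (T := 7) (I := fun i s => ∃ w',
    s = state { r with k := i, N := i * i } w' ∧ w'.E = r.n - (i * i + i + i)) ?_ ?_ ?_).mono ?_
  · rintro i hi s ⟨w', rfl, hw'⟩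
    have h1 : (i + 1) * (i + 1) ≤ r.n := by
      have := Nat.mul_le_mul hi hi
      exact this.trans (Nat.sqrt_le _)
    have e : i * i + i + i + 1 = (i + 1) * (i + 1) := by ring
    simp only [reaches_seq, reaches_add, reaches_sub, set_C, set_E, set_k, set_N, reg_C, reg_E,
      reg_k, reg_N, reg_n, reg_one, e]
    refine ⟨by rw [hw']; omega, ⟨_, rfl, rfl⟩, by norm_num⟩
  · rintro s ⟨w', rfl, hw'⟩
    rw [reg_E, hw']
    have : r.n ≤ r.n.sqrt * r.n.sqrt + r.n.sqrt + r.n.sqrt := Nat.sqrt_le_add _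
    omega
  · exact ⟨_, rfl, rfl⟩
  · rintro s t ⟨⟨w', rfl, -⟩, ht⟩
    apply h
    omega

/-- Exchanges the registers `11` and `12`. -/
def swap : Program := copy 18 11 ;; copy 11 12 ;; copy 12 18

lemma reaches_swap {Q : State → ℕ → Prop} {r : Main} {w : Temp} :
    Reaches swap Q (state r w) ↔ Q (state r { w with x := w.y, y := w.x, C := w.x }) 3 := by
  simp only [swap, reaches_seq, reaches_copy, set_C, set_x, set_y, reg_C, reg_x, reg_y]

/-- Applies to the registers `11` and `12` the shear given by the register `16`. -/
def shear : Program :=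
  sub 19 16 3 ;; ite 19 (const 17 2 ;; sub 16 16 17 ;; sub 18 4 12) (copy 18 12) ;;
  add 16 16 11 ;; add 16 16 18 ;; add 16 16 18 ;; copy 17 4 ;; divMod ;; copy 11 16

/-- Register `15` is left alone, so `walkStep` can test it again afterwards to undo its swap. -/
lemma reaches_shear {Q : State → ℕ → Prop} {r : Main} {w : Temp} (hk : 0 < r.k) (hy : w.y ≤ r.k)
    (h : ∀ A B C E, ∀ t ≤ 5 * w.A + 5 * w.x + 10 * r.k + 15,
      Q (state r { w with x := (Torus.shearNat r.k w.A (w.x, w.y)).1, A, B, C, E }) t) :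
    Reaches shear Q (state r w) := by
  simp only [shear, reaches_seq, reaches_ite, reaches_sub, set_E, reg_A, reg_E, reg_one]
  split_ifs with h1
  · have h2 : 2 ≤ w.A := by omega
    have e : w.A - 2 + w.x + (r.k - w.y) + (r.k - w.y) =
        w.x + (r.k - w.y) + (r.k - w.y) + (w.A - 2) := by omega
    simp only [reaches_const, reaches_add, reaches_copy, set_A, set_B, set_C, reg_A,
      reg_B, reg_C, reg_x, reg_y, reg_k]
    refine reaches_divMod hk fun t ht => ?_
    simp only [Torus.shearNat, if_pos h2, set_x, reg_A, e] at h ht ⊢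
    apply h
    omega
  · have h2 : ¬ 2 ≤ w.A := by omega
    have e : w.A + w.x + w.y + w.y = w.x + w.y + w.y + w.A := by omega
    simp only [reaches_add, reaches_copy, set_A, set_B, set_C, reg_A, reg_C, reg_x, reg_y, reg_k]
    refine reaches_divMod hk fun t ht => ?_
    simp only [Torus.shearNat, if_neg h2, set_x, reg_A, e] at h ht ⊢
    apply h
    omega

lemma shearNat_snd (k r : ℕ) (p : ℕ × ℕ) : (Torus.shearNat k r p).2 = p.2 := by
  unfold Torus.shearNat
  split_ifs <;> rfl

/-- Applies to the registers `11` and `12` the step given by the last base `8` digit of register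
`13`, and removes this digit. -/
def walkStep : Program :=
  copy 16 13 ;; const 17 8 ;; divMod ;; copy 13 18 ;; const 17 3 ;; sub 15 16 17 ;;
  ite 15 (const 17 4 ;; sub 16 16 17 ;; swap) skip ;; shear ;; ite 15 swap skip

lemma reaches_walkStep {Q : State → ℕ → Prop} {r : Main} {w : Temp} (hk : 0 < r.k)
    (hx : w.x < r.k) (hy : w.y < r.k)
    (h : ∀ w', w'.x = (Torus.stepNat r.k (w.i % 8) (w.x, w.y)).1 →
      w'.y = (Torus.stepNat r.k (w.i % 8) (w.x, w.y)).2 → w'.i = w.i / 8 → w'.c = w.c →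
      ∀ t ≤ 5 * w.i + 15 * r.k + 80, Q (state r w') t) :
    Reaches walkStep Q (state r w) := by
  have h8 : w.i % 8 < 8 := Nat.mod_lt _ (by norm_num)
  simp only [walkStep, reaches_seq, reaches_copy, reaches_const, set_A, set_B, reg_i]
  refine reaches_divMod (by simp) fun t1 ht1 => ?_
  simp only [reaches_sub, reaches_ite, set_B, set_e, set_i, reg_A, reg_B, reg_C, reg_e] at ht1 ⊢
  split_ifs with h1
  · have h4 : 4 ≤ w.i % 8 := by omega
    simp only [reaches_seq, reaches_const, reaches_sub, reaches_swap, set_A, set_B, reg_A, reg_B]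
    refine reaches_shear hk hx.le fun A B C E t2 ht2 => ?_
    refine (if_pos (by exact h1)).mpr (reaches_swap.2 ?_)
    simp only at ht2
    apply h
    · simp only [Torus.stepNat, if_pos h4, Prod.fst_swap, shearNat_snd, Prod.snd_swap]
    · simp only [Torus.stepNat, if_pos h4, Prod.snd_swap, Prod.swap_prod_mk]
    · rfl
    · rfl
    · omega
  · have h4 : ¬ 4 ≤ w.i % 8 := by omega
    simp only [reaches_skip]
    refine reaches_shear hk hy.le fun A B C E t2 ht2 => ?_
    refine (if_neg (by exact h1)).mpr ?_
    apply h
    · simp only [Torus.stepNat, if_neg h4]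
    · simp only [Torus.stepNat, if_neg h4, shearNat_snd]
    · rfl
    · rfl
    · simp only at ht2
      omega

/-- The end of the walk number `j` that starts in the cell number `u`; its number goes to register
`16`. -/
def walk : Program :=
  copy 16 8 ;; copy 17 4 ;; divMod ;; copy 11 18 ;; copy 12 16 ;; copy 13 10 ;; const 14 1 ;;
  sub 15 2 14 ;;
  loop 15 (walkStep ;; add 14 14 14 ;; add 14 14 14 ;; add 14 14 14 ;; sub 15 2 14) ;;
  copy 16 11 ;; copy 17 4 ;; mul ;; add 16 18 12

/-- The machine knows `8^t` but not `t`: register `14` runs through the powers of `8` until it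
reaches `D`. The invariant says that the remaining digits lead from the current point to the final
one. -/
lemma reaches_walk {Q : State → ℕ → Prop} {r : Main} {w : Temp} {t : ℕ} (hk : 0 < r.k)
    (hu : r.u < r.k * r.k) (hD : r.D = 8 ^ t)
    (h : ∀ w', w'.A = (Torus.walkNat r.k t r.j (r.u / r.k, r.u % r.k)).1 * r.k +
        (Torus.walkNat r.k t r.j (r.u / r.k, r.u % r.k)).2 →
      ∀ T ≤ 5 * r.u + 3 * r.k + t * (5 * r.j + 15 * r.k + 85) + 20, Q (state r w') T) :
    Reaches walk Q (state r w) := by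
  have : NeZero r.k := ⟨hk.ne'⟩
  simp only [walk, reaches_seq, reaches_copy, reaches_const, set_A, set_B, reg_u, reg_k]
  refine reaches_divMod hk fun t1 ht1 => ?_
  simp only [reaches_sub, set_x, set_y, set_i, set_c, set_e, reg_A,
    reg_C, reg_c, reg_j, reg_D] at ht1 ⊢
  refine (reaches_loop (c := t) (T := 5 * r.j + 15 * r.k + 84) (I := fun i s => ∃ w',
    s = state r w' ∧ w'.x < r.k ∧ w'.y < r.k ∧ w'.i ≤ r.j ∧ w'.c = 8 ^ i ∧ w'.e = r.D - w'.c ∧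
      Torus.walkNat r.k (t - i) w'.i (w'.x, w'.y) =
        Torus.walkNat r.k t r.j (r.u / r.k, r.u % r.k)) ?_ ?_ ?_).mono ?_
  · rintro i hi s ⟨w', rfl, h1, h2, h3, h4, h5, h6⟩
    refine ⟨?_, ?_⟩
    · rw [reg_e, h5, h4, hD]
      exact (Nat.sub_pos_of_lt (Nat.pow_lt_pow_right (by norm_num) hi)).ne'
    · rw [reaches_seq]
      refine reaches_walkStep hk h1 h2 fun w'' hx hy hi' hc t2 ht2 => ?_
      simp only [reaches_seq, reaches_add, reaches_sub, set_c, set_e, reg_c, reg_D]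
      obtain ⟨h7, h8⟩ := Torus.stepNat_lt (w'.i % 8) (p := (w'.x, w'.y)) h1 h2
      refine ⟨⟨_, rfl, ?_, ?_, ?_, ?_, rfl, ?_⟩, ?_⟩
      · simpa only [hx] using h7
      · simpa only [hy] using h8
      · simp only [hi']
        exact (Nat.div_le_self _ _).trans h3
      · simp only [hc, h4]
        ring
      · simp only [hx, hy, hi', Prod.mk.eta]
        rw [← h6, show t - i = (t - (i + 1)) + 1 by omega, Torus.walkNat]
      · omega
  · rintro s ⟨w', rfl, h1, h2, h3, h4, h5, h6⟩
    rw [reg_e, h5, h4, hD, Nat.sub_self]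
  · exact ⟨_, rfl, Nat.div_lt_of_lt_mul hu, Nat.mod_lt _ hk, le_rfl, rfl, rfl, rfl⟩
  · rintro s t2 ⟨⟨w', rfl, h1, h2, h3, h4, h5, h6⟩, ht2⟩
    simp only [set_A, set_B, reg_x, reg_k]
    refine reaches_mul fun t3 ht3 => ?_
    simp only [reaches_add, set_A, reg_C, reg_y] at ht3 ⊢
    rw [Nat.sub_self, Torus.walkNat] at h6
    apply h
    · rw [← h6]
    · have : t * (5 * r.j + 15 * r.k + 84 + 1) = t * (5 * r.j + 15 * r.k + 85) := rfl
      omega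

/-- Writes the edge from `u` to the residue of register `16` modulo `m`. -/
def writePair : Program := copy 17 1 ;; divMod ;; write 8 ;; write 16

lemma reaches_writePair {Q : State → ℕ → Prop} {r : Main} {w : Temp} (hm : 0 < r.m)
    (h : ∀ w', ∀ t ≤ 5 * w.A + 7,
      Q (state { r with out := r.out ++ [r.u, w.A % r.m] } w') t) :
    Reaches writePair Q (state r w) := by
  simp only [writePair, reaches_seq, reaches_copy, set_B, reg_m]
  refine reaches_divMod hm fun t ht => ?_
  simp only [reaches_write, reg_u, reg_A, List.append_assoc, List.singleton_append]
    at ht ⊢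
  apply h
  omega

/-- Writes the edge number `j` at the left vertex `u`. -/
def writeEdge : Program :=
  ite 6 (add 16 8 10 ;; copy 17 0 ;; divMod) (sub 19 5 8 ;; ite 19 walk (copy 16 8)) ;; writePair

/-- The flag `D + 1 - n²` is nonzero exactly when `n² ≤ D`. As `t ≤ 8^t ≤ z`, the walk takes at most
`z` passes, each of cost linear in `z`. -/
lemma reaches_writeEdge {Q : State → ℕ → Prop} {r : Main} {w : Temp} {t z : ℕ} (hm : 0 < r.m)
    (hk : r.k = r.n.sqrt) (hN : r.N = r.k * r.k) (hf : r.f = r.D + 1 - r.n * r.n)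
    (hu : r.u < r.n) (hj : r.j < r.D) (hD : r.D = 8 ^ t) (hn : r.n ≤ z) (hDz : r.D ≤ z)
    (h : ∀ w', ∀ T ≤ 200 * z ^ 2,
      Q (state { r with out := r.out ++ [r.u, Torus.dest r.n t r.j r.u % r.m] } w') T) :
    Reaches writeEdge Q (state r w) := by
  have hz : 1 ≤ z := by omega
  have hzz : z ≤ z * z := Nat.le_mul_self z
  have hkn : r.k ≤ r.n := hk ▸ Nat.sqrt_le_self _
  have hk0 : 0 < r.k := by rw [hk, Nat.sqrt_pos]; omega
  have htz : t ≤ z := (Nat.lt_pow_self (by norm_num : 1 < 8)).le.trans (hD ▸ hDz)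
  have hT : t * (5 * r.j + 15 * r.k + 85) ≤ z * (105 * z) := by
    apply Nat.mul_le_mul htz
    omega
  have hT' : z * (105 * z) = 105 * (z * z) := by ring
  have hdest : Torus.dest r.n t r.j r.u < r.n := Torus.dest_lt t r.j hu
  rw [sq] at h
  simp only [writeEdge, reaches_seq, reaches_ite, reg_f]
  split_ifs with h1
  · have h2 : r.n * r.n ≤ 8 ^ t := by omega
    have h3 : (r.u + r.j) % r.n = Torus.dest r.n t r.j r.u := by rw [Torus.dest, if_pos h2]
    simp only [reaches_add, reaches_copy, set_A, set_B, reg_u, reg_j, reg_n]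
    refine reaches_divMod (by simp only; omega) fun t1 ht1 => ?_
    refine reaches_writePair hm fun w' t2 ht2 => ?_
    simp only [h3] at ht1 ht2 ⊢
    apply h
    omega
  · have h2 : ¬ r.n * r.n ≤ 8 ^ t := by omega
    simp only [reaches_sub, set_E, reg_N, reg_u, reg_E]
    split_ifs with h3
    · have h4 : r.u < r.k * r.k := by omega
      refine reaches_walk hk0 h4 hD fun w' hw' T hT' => ?_
      have h5 : w'.A = Torus.dest r.n t r.j r.u := by
        rw [hw', Torus.dest, if_neg h2, ← hk, if_pos h4]
      refine reaches_writePair hm fun w'' t2 ht2 => ?_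
      rw [h5] at ht2 ⊢
      apply h
      omega
    · have h4 : ¬ r.u < r.n.sqrt * r.n.sqrt := by rw [← hk]; omega
      have h5 : r.u = Torus.dest r.n t r.j r.u := by rw [Torus.dest, if_neg h2, if_neg h4]
      simp only [reaches_copy, set_A, reg_u]
      refine reaches_writePair hm fun w'' t2 ht2 => ?_
      simp only at ht2 ⊢
      rw [← h5] at h
      apply h
      omega

/-! ### The whole program -/

/-- Writes all edges at the left vertex `u`. -/
def writeStar : Program :=
  copy 9 2 ;; const 10 0 ;; loop 9 (writeEdge ;; sub 9 9 3 ;; add 10 10 3)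

/-- The part of the output that belongs to the left vertex `u`. -/
def star (n m t u : ℕ) : List ℕ :=
  (List.range (8 ^ t)).flatMap fun j => [u, Torus.dest n t j u % m]

lemma reaches_writeStar {Q : State → ℕ → Prop} {r : Main} {w : Temp} {t z : ℕ} (hm : 0 < r.m)
    (hk : r.k = r.n.sqrt) (hN : r.N = r.k * r.k) (hf : r.f = r.D + 1 - r.n * r.n)
    (hu : r.u < r.n) (hD : r.D = 8 ^ t) (hn : r.n ≤ z) (hDz : r.D ≤ z)
    (h : ∀ b j w', ∀ T ≤ 210 * z ^ 3,
      Q (state { r with b := b, j := j, out := r.out ++ star r.n r.m t r.u } w') T) :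
    Reaches writeStar Q (state r w) := by
  simp only [writeStar, reaches_seq, reaches_copy, reaches_const, set_b, set_j, reg_D]
  refine (reaches_loop (c := r.D) (T := 200 * z ^ 2 + 2) (I := fun i s => ∃ w',
    s = state { r with b := r.D - i, j := i, out := r.out ++ ((List.range i).flatMap
      fun j => [r.u, Torus.dest r.n t j r.u % r.m]) } w') ?_ ?_ ?_).mono ?_
  · rintro i hi s ⟨w', rfl⟩
    refine ⟨by rw [reg_b]; simp only; omega, ?_⟩
    rw [reaches_seq]
    refine reaches_writeEdge (z := z) (t := t) hm hk hN hf hu hi hD hn hDz fun w'' T hT => ?_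
    simp only [reaches_seq, reaches_add, reaches_sub, set_b, set_j, reg_b, reg_j, reg_one]
    refine ⟨⟨w'', ?_⟩, by omega⟩
    rw [Nat.sub_sub, List.range_succ, List.flatMap_append, List.flatMap_singleton,
      List.append_assoc]
  · rintro s ⟨w', rfl⟩
    rw [reg_b, Nat.sub_self]
  · exact ⟨w, by simp⟩
  · rintro s T ⟨⟨w', rfl⟩, hT⟩
    rw [star, ← hD] at h
    apply h
    have hz : 1 ≤ z := by omega
    have h1 : r.D * (200 * z ^ 2 + 2 + 1) ≤ z * (203 * z ^ 2) := by
      apply Nat.mul_le_mul hDz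
      have : 1 ≤ z ^ 2 := Nat.one_le_pow _ _ hz
      omega
    have h2 : z * (203 * z ^ 2) = 203 * z ^ 3 := by ring
    have h3 : 1 ≤ z ^ 3 := Nat.one_le_pow _ _ hz
    omega

/-- The algorithm. -/
def build : Program :=
  const 3 1 ;; sqrt ;; copy 16 0 ;; copy 17 0 ;; mul ;; add 6 2 3 ;; sub 6 6 18 ;;
  copy 7 0 ;; const 8 0 ;; loop 7 (writeStar ;; sub 7 7 3 ;; add 8 8 3)

lemma initial_set (n m d : ℕ) : (initial n m d).set 3 1 =
    state ⟨n, m, d, 0, 0, 0, 0, 0, 0, 0, []⟩ ⟨0, 0, 0, 0, 0, 0, 0, 0, 0⟩ := by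
  have : initial n m d = ofList [n, m, d, 0, 0, 0, 0, 0, 0, 0, 0, 0, 0, 0, 0, 0, 0, 0, 0, 0] [] := by
    unfold initial ofList
    congr 1
    funext i
    rcases i with _ | _ | _ | i
    · rfl
    · rfl
    · rfl
    · have : ∀ l : List ℕ, (∀ a ∈ l, a = 0) → l.getD i 0 = 0 := by
        intro l hl
        by_cases hi : i < l.length
        · rw [List.getD_eq_getElem _ _ hi]
          exact hl _ (List.getElem_mem hi)
        · rw [List.getD_eq_default _ _ (not_lt.1 hi)]
      simp only [List.getD_cons_succ]
      rw [this _ (by simp)]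
      simp
  rw [this]
  exact ofList_set (by simp)

theorem outputsWithin_build {n m t z : ℕ} (hm : 0 < m) (hn : n ≤ z) (hD : 8 ^ t ≤ z) :
    OutputsWithin build n m (8 ^ t) ((List.range n).flatMap (star n m t)) (250 * z ^ 4) := by
  have hz : 1 ≤ z := (Nat.one_le_pow _ _ (by norm_num)).trans hD
  suffices h : Reaches build
      (fun s T => s.out = (List.range n).flatMap (star n m t) ∧ T ≤ 250 * z ^ 4)
      (initial n m (8 ^ t)) by
    obtain ⟨s, T, h1, h2, h3⟩ := h
    exact ⟨s, T, h1, h2, h3⟩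
  simp only [build, reaches_seq, reaches_const, initial_set]
  refine reaches_sqrt fun w1 t1 ht1 => ?_
  simp only [reaches_copy, set_A, set_B, reg_n] at ht1 ⊢
  refine reaches_mul fun t2 ht2 => ?_
  simp only [reaches_add, reaches_sub, set_f, set_a, set_u, reg_D, reg_one, reg_f,
    reg_C, reg_n] at ht2 ⊢
  refine (reaches_loop (c := n) (T := 210 * z ^ 3 + 2) (I := fun i s => ∃ b j w',
    s = state ⟨n, m, 8 ^ t, n.sqrt, n.sqrt * n.sqrt, 8 ^ t + 1 - n * n, n - i, i, b, j,
      (List.range i).flatMap (star n m t)⟩ w') ?_ ?_ ?_).mono ?_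
  · rintro i hi s ⟨b, j, w', rfl⟩
    refine ⟨by rw [reg_a]; simp only; omega, ?_⟩
    rw [reaches_seq]
    refine reaches_writeStar (z := z) (t := t) hm rfl rfl rfl hi rfl hn hD
      fun b' j' w'' T hT => ?_
    simp only [reaches_seq, reaches_add, reaches_sub, set_a, set_u, reg_a, reg_u, reg_one]
    refine ⟨⟨b', j', w'', ?_⟩, by omega⟩
    rw [Nat.sub_sub, List.range_succ, List.flatMap_append, List.flatMap_singleton]
  · rintro s ⟨b, j, w', rfl⟩
    rw [reg_a, Nat.sub_self]
  · exact ⟨_, _, _, rfl⟩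
  · rintro s T ⟨⟨b, j, w', rfl⟩, hT⟩
    refine ⟨rfl, ?_⟩
    have h1 : n * (210 * z ^ 3 + 2 + 1) ≤ z * (213 * z ^ 3) := by
      apply Nat.mul_le_mul hn
      have : 1 ≤ z ^ 3 := Nat.one_le_pow _ _ hz
      omega
    have h2 : z * (213 * z ^ 3) = 213 * z ^ 4 := by ring
    have h3 : z ≤ z ^ 4 := Nat.le_self_pow (by norm_num) z
    omega

end RAM

/-! ### Running time in the size of the graph, and choice of the walk length -/

namespace Torus

lemma isEdgeList_graph {n m t : ℕ} (hm : 0 < m) :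
    (graph n m t hm).IsEdgeList ((List.range n).flatMap (RAM.star n m t)) := by
  refine ⟨edgeList n m t hm, rfl, ?_⟩
  rw [edgeList, List.flatMap_assoc, ← List.map_coe_finRange_eq_range, List.flatMap_map]
  refine List.flatMap_congr fun u _ => ?_
  rw [RAM.star, List.flatMap_map]

lemma buildsInTime_graph {n m t : ℕ} (hm : 0 < m) (hn : 0 < n) :
    BuildsInTime RAM.build (Polynomial.C 250 * Polynomial.X ^ 4) (8 ^ t) (graph n m t hm) := by
  refine ⟨_, isEdgeList_graph hm, ?_⟩
  have h : (graph n m t hm).size = n + m + n * 8 ^ t := by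
    rw [BipMultigraph.size, card_edges_graph]
  rw [Polynomial.eval_mul, Polynomial.eval_C, Polynomial.eval_pow, Polynomial.eval_X]
  apply RAM.outputsWithin_build hm
  · rw [h]; omega
  · rw [h]
    exact (Nat.le_mul_of_pos_left _ hn).trans (Nat.le_add_left _ _)

/-- The number of steps of the walk, for a gap `x` between the densities and an error `y`. -/
lemma exists_walk_length {x y : ℝ} (hx : 0 < x) (hy : 0 < y) :
    ∃ t : ℕ, 10 * (11 / 12 : ℝ) ^ t ≤ x * y ∧ (11 / 12 : ℝ) ^ t ≤ x ∧
      (8 : ℝ) ^ t ≤ (11 * (1 + 1 / x) * (1 + 1 / y)) ^ 24 := by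
  set X : ℝ := 10 * (1 + 1 / x) * (1 + 1 / y) with hX
  have hx' : 0 < 1 / x := by positivity
  have hy' : 0 < 1 / y := by positivity
  have hX1 : 1 ≤ X := by nlinarith [mul_pos hx' hy']
  -- `(12/11)^s ≤ X < (12/11)^(s+1)`: the upper inequality makes the errors small, the lower one
  -- keeps the degree polynomial.
  obtain ⟨s, hs1, hs2⟩ := exists_nat_pow_near hX1 (by norm_num : (1 : ℝ) < 12 / 11)
  have hpow : (11 / 12 : ℝ) ^ (s + 1) * (12 / 11) ^ (s + 1) = 1 := by
    rw [← mul_pow]; norm_num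
  have hp : (0 : ℝ) < (11 / 12) ^ (s + 1) := by positivity
  have h1 : (11 / 12 : ℝ) ^ (s + 1) * X ≤ 1 := by
    rw [← hpow]; gcongr
  have h2 : 10 * (1 / x * (1 / y)) ≤ X := by nlinarith [mul_pos hx' hy']
  have h3 : 1 / x ≤ X := by nlinarith [mul_pos hx' hy']
  refine ⟨s + 1, ?_, ?_, ?_⟩
  · have h4 : (11 / 12 : ℝ) ^ (s + 1) * (10 * (1 / x * (1 / y))) ≤ 1 := le_trans (by gcongr) h1
    have h5 : (11 / 12 : ℝ) ^ (s + 1) * (10 * (1 / x * (1 / y))) =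
        10 * (11 / 12 : ℝ) ^ (s + 1) / (x * y) := by field_simp
    rwa [h5, div_le_one (by positivity)] at h4
  · have h4 : (11 / 12 : ℝ) ^ (s + 1) * (1 / x) ≤ 1 := le_trans (by gcongr) h1
    rwa [mul_one_div, div_le_one hx] at h4
  -- The exponent `24` comes from `8 ≤ (12/11)^24`, and the factor `11` from `12/11 · 10 < 11`.
  · calc (8 : ℝ) ^ (s + 1) ≤ ((12 / 11) ^ 24) ^ (s + 1) := by gcongr; norm_num
      _ = (12 / 11 * (12 / 11) ^ s) ^ 24 := by
        rw [← pow_mul, mul_comm 24, pow_mul, pow_succ' (12 / 11 : ℝ) s]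
      _ ≤ (12 / 11 * X) ^ 24 := by gcongr
      _ ≤ _ := by
        gcongr ?_ ^ 24
        rw [hX]
        nlinarith [mul_pos hx' hy']

end Torus

theorem mainTheorem8 :
    ∃ (P : MvPolynomial (Fin 3) ℝ) (p : RAM.Program) (T : Polynomial ℕ),
      ∀ α β μ : ℝ, 0 < α → α < β → β < 1 → 0 < μ →
        ∃ D : ℕ, 0 < D ∧ (D : ℝ) ≤ MvPolynomial.eval ![1 / α, 1 / (β - α), 1 / μ] P ∧
          ∀ n m : ℕ, 1 ≤ m → m ≤ n →
            ∃ G : BipMultigraph n m,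
              BuildsInTime p T D G ∧
              (∀ u : Fin n, G.leftDegree u = D) ∧
              (∀ v : Fin m, D * (n / m) ≤ G.rightDegree v ∧
                G.rightDegree v ≤ 2 * (D * (n / m))) ∧
              ∀ S : Finset (Fin n), (S.card : ℝ) ≤ α * (n : ℝ) →
                ((G.overloaded β S).card : ℝ) < μ * (m : ℝ) := by
  refine ⟨(MvPolynomial.C 11 * (1 + MvPolynomial.X 1) * (1 + MvPolynomial.X 2)) ^ 24, RAM.build,
    Polynomial.C 250 * Polynomial.X ^ 4, fun α β μ hα hαβ hβ hμ => ?_⟩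
  obtain ⟨t, h1, h2, h3⟩ := Torus.exists_walk_length (sub_pos.2 hαβ) hμ
  refine ⟨8 ^ t, by positivity, ?_, fun n m hm hmn => ⟨Torus.graph n m t hm,
    Torus.buildsInTime_graph hm (hm.trans hmn), Torus.leftDegree_graph hm, fun v => ?_,
    Torus.card_overloaded_lt hm hmn hα hαβ hβ hμ h1 h2⟩⟩
  · simpa using h3
  · obtain ⟨h4, h5⟩ := Torus.card_fiber_bounds hmn v
    rw [Torus.rightDegree_graph, mul_left_comm]
    exact ⟨Nat.mul_le_mul_left _ h4, Nat.mul_le_mul_left _ h5⟩
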